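/- Let $M$ be a (Hausdorff) smooth manifold of real dimension $\ell+2$, and let $\mathcal F$ be a transversely holomorphic foliation of complex codimension one on $M$: it is given by an open cover of $M$ and smooth submersions $y_i\colon U_i\to\mathbb C$, with $\mathcal F$ given by $y_i=\mathrm{const}$ in $U_i$, which differ on overlaps locally by biholomorphic maps between open subsets of $\mathbb C$. A function on an open subset of $M$ is transversely holomorphic if it is locally a holomorphic function of some $y_i$. Let $\Lambda\subset M$ be a compact curve, i.e. a compact set with empty interior which near each of its points is the zero set of a transversely holomorphic function (so $\Lambda$ is a finite union of compact leaves of $\mathcal F$). Assume that $\mathcal F$ is $\mathbb C$-transversely affine on $M\setminus\Lambda$: there are an open cover $(V_j)$ of $M\setminus\Lambda$ and transversely holomorphic submersions $w_j\colon V_j\to\mathbb C$ defining $\mathcal F$ in $V_j\subset M\setminus\Lambda$ with $w_i=a_{ij}w_j+b_{ij}$ on $V_i\cap V_j$, where $a_{ij}\colon V_i\cap V_j\to\mathbb C\setminus\{0\}$ and $b_{ij}\colon V_i\cap V_j\to\mathbb C$ are locally constant. Then for every leaf $L$ of $\mathcal F$ with $L\subset\Lambda$, every point $p\in L$ and every holomorphic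 disc $D$ through $p$ transverse to $\mathcal F$, the holonomy group $\mathrm{Hol}(\mathcal F,L,D,p)<\mathrm{Diff}(\mathbb C,0)$, the group of germs at $p$ of the holonomy maps $D\to D$ of loops in $L$ based at $p$, is solvable. -/

import Mathlib

open Set Filter TopologicalSpace
open scoped Topology Manifold ContDiff

/-! ### The group `Diff(ℂ, 0)` of germs of holomorphic diffeomorphisms fixing the origin -/

/-- Maps `ℂ → ℂ` that are holomorphic near `0` and fix `0`, under composition. -/
def holomorphicFixingZero : Submonoid (Function.End ℂ) where
  carrier := {f | AnalyticAt ℂ (f : ℂ → ℂ) 0 ∧ (f : ℂ → ℂ) 0 = 0}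
  one_mem' := ⟨analyticAt_id, rfl⟩
  mul_mem' := by
    rintro f g ⟨hf, hf0⟩ ⟨hg, hg0⟩
    refine ⟨?_, ?_⟩
    · change AnalyticAt ℂ ((f : ℂ → ℂ) ∘ (g : ℂ → ℂ)) 0
      apply AnalyticAt.comp _ hg
      rw [hg0]
      exact hf
    · change (f : ℂ → ℂ) ((g : ℂ → ℂ) 0) = 0
      rw [hg0, hf0]

/-- The monoid of maps `ℂ → ℂ` that are holomorphic near `0` and fix `0`. -/
abbrev HolMap : Type := holomorphicFixingZero

/-- The underlying function of an element of `HolMap`. -/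
def HolMap.fn (f : HolMap) : ℂ → ℂ := f.1

theorem HolMap.analyticAt (f : HolMap) : AnalyticAt ℂ f.fn 0 :=
  f.2.1

theorem HolMap.fn_zero (f : HolMap) : f.fn 0 = 0 := f.2.2

theorem HolMap.tendsto (f : HolMap) :
    Tendsto f.fn (𝓝 0) (𝓝 0) := by
  have h := f.analyticAt.continuousAt.tendsto
  rwa [f.fn_zero] at h

theorem HolMap.mul_fn (f g : HolMap) :
    (f * g).fn = f.fn ∘ g.fn := rfl

theorem HolMap.one_fn : (1 : HolMap).fn = id := rfl

/-- Two maps are identified when they have the same germ at `0`. -/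
def sameGermAtZero : Con HolMap where
  r f g := f.fn =ᶠ[𝓝 0] g.fn
  iseqv := ⟨fun _ => EventuallyEq.rfl, fun h => h.symm, fun h h' => h.trans h'⟩
  mul' := by
    intro f f' g g' h h'
    change f.fn ∘ g.fn =ᶠ[𝓝 0] f'.fn ∘ g'.fn
    have h1 : f.fn ∘ g.fn =ᶠ[𝓝 0] f'.fn ∘ g.fn := h.comp_tendsto g.tendsto
    exact h1.trans (h'.fun_comp f'.fn)

/-- `Diff(ℂ, 0)`: the invertible germs at `0` of holomorphic maps fixing `0`,
with composition of germs as multiplication. -/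
abbrev DiffGerm : Type := (sameGermAtZero.Quotient)ˣ

/-- `f` is a representative of the germ `φ`. -/
def DiffGerm.IsRep (φ : DiffGerm) (f : HolMap) : Prop :=
  (f : sameGermAtZero.Quotient) = (φ : sameGermAtZero.Quotient)

/-! ### Transversely holomorphic foliations of complex codimension one -/

section Foliation

variable {ℓ : ℕ} {M : Type*} [TopologicalSpace M]
  [ChartedSpace (EuclideanSpace ℝ (Fin (ℓ + 2))) M]

/-- A transversely holomorphic foliation of complex codimension one on the manifold `M` of real
dimension `ℓ + 2`: a cover of `M` by open sets `U` with smooth submersions `y : U → ℂ` (the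
foliation is `y = const` in `U`; values of `y` off `U` are irrelevant) such that any two of them
differ locally by a biholomorphic map between open subsets of `ℂ`. -/
structure TransverselyHolomorphicFoliation (ℓ : ℕ) (M : Type*) [TopologicalSpace M]
    [ChartedSpace (EuclideanSpace ℝ (Fin (ℓ + 2))) M] where
  atlas : Set (Opens M × (M → ℂ))
  covers : ∀ p : M, ∃ u ∈ atlas, p ∈ u.1
  smooth : ∀ u ∈ atlas, ContMDiffOn (𝓡 (ℓ + 2)) 𝓘(ℝ, ℂ) ∞ u.2 (u.1 : Set M)
  submersion : ∀ u ∈ atlas, ∀ p ∈ u.1,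
    Function.Surjective (mfderiv (𝓡 (ℓ + 2)) 𝓘(ℝ, ℂ) u.2 p)
  compatible : ∀ u ∈ atlas, ∀ v ∈ atlas, ∀ p : M, p ∈ u.1 → p ∈ v.1 →
    ∃ g : ℂ → ℂ, AnalyticAt ℂ g (u.2 p) ∧ deriv g (u.2 p) ≠ 0 ∧ v.2 =ᶠ[𝓝 p] g ∘ u.2

namespace TransverselyHolomorphicFoliation

/-- `f` is a transversely holomorphic function on `U`: near each point of `U` it is a holomorphic
function of the transverse coordinate. -/
def IsTransverselyHolomorphicOn (F : TransverselyHolomorphicFoliation ℓ M) (f : M → ℂ)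
    (U : Set M) : Prop :=
  ∀ p ∈ U, ∃ u ∈ F.atlas, p ∈ u.1 ∧
    ∃ g : ℂ → ℂ, AnalyticAt ℂ g (u.2 p) ∧ f =ᶠ[𝓝 p] g ∘ u.2

/-- `y : U → ℂ` is a transversely holomorphic submersion defining the foliation in `U`: near each
point of `U` it is a biholomorphic function of the transverse coordinate. -/
def IsTransverseSubmersionOn (F : TransverselyHolomorphicFoliation ℓ M) (y : M → ℂ)
    (U : Set M) : Prop :=
  ∀ p ∈ U, ∃ u ∈ F.atlas, p ∈ u.1 ∧
    ∃ g : ℂ → ℂ, AnalyticAt ℂ g (u.2 p) ∧ deriv g (u.2 p) ≠ 0 ∧ y =ᶠ[𝓝 p] g ∘ u.2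

/-- The foliation is `ℂ`-transversely affine on the open set `W`: `W` has a cover by open sets
`U ⊆ W` with transversely holomorphic submersions `y : U → ℂ` defining the foliation and satisfying
`y' = a y + b` on overlaps, with `a ≠ 0` and `b` locally constant. -/
def IsTransverselyAffineOn (F : TransverselyHolomorphicFoliation ℓ M) (W : Set M) : Prop :=
  ∃ A : Set (Opens M × (M → ℂ)),
    (∀ p ∈ W, ∃ u ∈ A, p ∈ u.1) ∧
    (∀ u ∈ A, (u.1 : Set M) ⊆ W ∧ F.IsTransverseSubmersionOn u.2 u.1) ∧
    ∀ u ∈ A, ∀ v ∈ A, ∃ a b : (u.1 ⊓ v.1 : Opens M) → ℂ,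
      IsLocallyConstant a ∧ IsLocallyConstant b ∧
      ∀ q : (u.1 ⊓ v.1 : Opens M), a q ≠ 0 ∧ v.2 q = a q * u.2 q + b q

/-- `γ : [0, 1] → M` is a leafwise path: it is continuous and the transverse coordinate is locally
constant along it (values of `γ` off `[0, 1]` are irrelevant). -/
def IsLeafwise (F : TransverselyHolomorphicFoliation ℓ M) (γ : ℝ → M) : Prop :=
  ContinuousOn γ (Icc 0 1) ∧
  ∀ t ∈ Icc (0 : ℝ) 1, ∃ u ∈ F.atlas, γ t ∈ u.1 ∧
    ∀ᶠ s in 𝓝[Icc (0 : ℝ) 1] t, u.2 (γ s) = u.2 (γ t)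

/-- The leaf through `p`: the endpoints of the leafwise paths that start at `p`. -/
def leaf (F : TransverselyHolomorphicFoliation ℓ M) (p : M) : Set M :=
  {q | ∃ γ : ℝ → M, F.IsLeafwise γ ∧ γ 0 = p ∧ γ 1 = q}

/-- `L` is a leaf of the foliation. -/
def IsLeaf (F : TransverselyHolomorphicFoliation ℓ M) (L : Set M) : Prop :=
  ∃ p, L = F.leaf p

/-- A compact curve: a compact set of complex codimension one which is analytic for the
transversely holomorphic structure, that is, a compact set with empty interior which near each of
its points is the zero set of a transversely holomorphic function. (Locally such a set is a
single plaque, so these sets are the finite unions of compact leaves.) -/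
def IsCompactCurve (F : TransverselyHolomorphicFoliation ℓ M) (Λ : Set M) : Prop :=
  IsCompact Λ ∧ interior Λ = ∅ ∧
    ∀ p ∈ Λ, ∃ (U : Opens M) (f : M → ℂ), p ∈ U ∧
      F.IsTransverselyHolomorphicOn f U ∧ Λ ∩ U = {q | q ∈ U ∧ f q = 0}

/-- A holomorphic transverse disc through `p`: an injective smooth map from the unit disc to `M`
sending `0` to `p`, along which the transverse coordinates are holomorphic with non-zero
derivative (so that it is an immersion transverse to the foliation). -/
structure TransverseDisc (F : TransverselyHolomorphicFoliation ℓ M) (p : M) where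
  toFun : ℂ → M
  map_zero : toFun 0 = p
  injOn : InjOn toFun (Metric.ball 0 1)
  smooth : ContMDiffOn 𝓘(ℝ, ℂ) (𝓡 (ℓ + 2)) ∞ toFun (Metric.ball 0 1)
  transverse : ∀ z ∈ Metric.ball (0 : ℂ) 1, ∀ u ∈ F.atlas, toFun z ∈ u.1 →
    AnalyticAt ℂ (u.2 ∘ toFun) z ∧ deriv (u.2 ∘ toFun) z ≠ 0

/-- `f` is a holonomy map on the transverse disc `D` at `p`: there is a continuous family
`H z : [0, 1] → M` of leafwise paths, for `z` in a neighborhood of `0`, where `H z` goes from the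
point `z` of `D` to the point `f z` of `D`. Since `f 0 = 0`, the path `H 0` is a loop at `p` in the
leaf of `p`, and the germ of `f` is its holonomy. -/
def IsHolonomyMap (F : TransverselyHolomorphicFoliation ℓ M) {p : M} (D : F.TransverseDisc p)
    (f : ℂ → ℂ) : Prop :=
  ∃ V ∈ 𝓝 (0 : ℂ), ∃ H : ℂ → ℝ → M,
    ContinuousOn (fun x : ℂ × ℝ => H x.1 x.2) (V ×ˢ Icc 0 1) ∧
    ∀ z ∈ V, F.IsLeafwise (H z) ∧ H z 0 = D.toFun z ∧ H z 1 = D.toFun (f z)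

theorem IsLeafwise.const (F : TransverselyHolomorphicFoliation ℓ M) (p : M) :
    F.IsLeafwise (fun _ => p) := by
  refine ⟨continuousOn_const, fun t _ => ?_⟩
  obtain ⟨u, hu, hp⟩ := F.covers p
  exact ⟨u, hu, hp, Eventually.of_forall fun _ => rfl⟩

theorem tendsto_reparam {c : ℝ → ℝ} (hc : Continuous c) {S T : Set ℝ} (h : MapsTo c S T) (t : ℝ) :
    Tendsto c (𝓝[S] t) (𝓝[T] (c t)) :=
  tendsto_nhdsWithin_of_tendsto_nhds_of_eventually_within _
    ((hc.tendsto t).mono_left nhdsWithin_le_nhds)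
    (by filter_upwards [self_mem_nhdsWithin] with s hs using h hs)

theorem mapsTo_reverse : MapsTo (fun t : ℝ => 1 - t) (Icc 0 1) (Icc 0 1) :=
  fun s hs => ⟨by linarith [hs.2], by linarith [hs.1]⟩

theorem mapsTo_left : MapsTo (fun t : ℝ => 2 * t) (Icc 0 (1 / 2)) (Icc 0 1) :=
  fun s hs => ⟨by linarith [hs.1], by linarith [hs.2]⟩

theorem mapsTo_right : MapsTo (fun t : ℝ => 2 * t - 1) (Icc (1 / 2) 1) (Icc 0 1) :=
  fun s hs => ⟨by linarith [hs.1], by linarith [hs.2]⟩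

/-- Any chart at a point of a leafwise path can be used. -/
theorem IsLeafwise.eventually {F : TransverselyHolomorphicFoliation ℓ M} {γ : ℝ → M}
    (h : F.IsLeafwise γ) {t : ℝ} (ht : t ∈ Icc (0 : ℝ) 1) {u : Opens M × (M → ℂ)}
    (hu : u ∈ F.atlas) (hp : γ t ∈ u.1) :
    ∀ᶠ s in 𝓝[Icc (0 : ℝ) 1] t, u.2 (γ s) = u.2 (γ t) := by
  obtain ⟨v, hv, hq, he⟩ := h.2 t ht
  obtain ⟨g, -, -, hg⟩ := F.compatible v hv u hu (γ t) hq hp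
  have h1 : ∀ᶠ s in 𝓝[Icc (0 : ℝ) 1] t, u.2 (γ s) = (g ∘ v.2) (γ s) :=
    (h.1 t ht).eventually hg
  have h2 : u.2 (γ t) = (g ∘ v.2) (γ t) := hg.self_of_nhds
  filter_upwards [he, h1] with s hs hs1
  rw [hs1, h2, Function.comp_apply, Function.comp_apply, hs]

theorem IsLeafwise.reverse {F : TransverselyHolomorphicFoliation ℓ M} {γ : ℝ → M}
    (h : F.IsLeafwise γ) : F.IsLeafwise (fun t => γ (1 - t)) := by
  refine ⟨h.1.comp (by fun_prop) mapsTo_reverse, fun t ht => ?_⟩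
  obtain ⟨u, hu, hp, he⟩ := h.2 (1 - t) (mapsTo_reverse ht)
  exact ⟨u, hu, hp, (tendsto_reparam (by fun_prop) mapsTo_reverse t).eventually he⟩

/-- Concatenation of two paths. -/
noncomputable def concat {X : Type*} (γ δ : ℝ → X) (t : ℝ) : X :=
  if t ≤ 1 / 2 then γ (2 * t) else δ (2 * t - 1)

theorem concat_left {X : Type*} (γ δ : ℝ → X) {t : ℝ} (h : t ≤ 1 / 2) : concat γ δ t = γ (2 * t) :=
  if_pos h

theorem concat_right {X : Type*} {γ δ : ℝ → X} (e : γ 1 = δ 0) {t : ℝ} (h : 1 / 2 ≤ t) :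
    concat γ δ t = δ (2 * t - 1) := by
  rcases h.eq_or_lt with h | h
  · subst h
    rw [concat_left _ _ le_rfl]
    norm_num [e]
  · exact if_neg h.not_ge

theorem Icc_halves : Icc (0 : ℝ) 1 = Icc 0 (1 / 2) ∪ Icc (1 / 2) 1 :=
  (Icc_union_Icc_eq_Icc (by norm_num) (by norm_num)).symm

theorem IsLeafwise.concat {F : TransverselyHolomorphicFoliation ℓ M} {γ δ : ℝ → M}
    (hγ : F.IsLeafwise γ) (hδ : F.IsLeafwise δ) (e : γ 1 = δ 0) :
    F.IsLeafwise (concat γ δ) := by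
  constructor
  · rw [Icc_halves]
    refine ContinuousOn.union_of_isClosed ?_ ?_ isClosed_Icc isClosed_Icc
    · exact (hγ.1.comp (by fun_prop) mapsTo_left).congr fun t ht => concat_left γ δ ht.2
    · exact (hδ.1.comp (by fun_prop) mapsTo_right).congr fun t ht => concat_right e ht.1
  · intro t ht
    obtain ⟨u, hu, hp⟩ := F.covers (TransverselyHolomorphicFoliation.concat γ δ t)
    refine ⟨u, hu, hp, ?_⟩
    rw [Icc_halves, nhdsWithin_union, eventually_sup]
    constructor
    · by_cases h : t ≤ 1 / 2
      · rw [concat_left γ δ h] at hp ⊢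
        have := (tendsto_reparam (by fun_prop) mapsTo_left t).eventually
          (hγ.eventually (mapsTo_left ⟨ht.1, h⟩) hu hp)
        filter_upwards [this, self_mem_nhdsWithin] with s hs hs'
        rw [concat_left γ δ hs'.2, hs]
      · have : ∀ᶠ s in 𝓝[Icc (0 : ℝ) (1 / 2)] t, False := by
          rw [eventually_nhdsWithin_iff]
          filter_upwards [Ioi_mem_nhds (not_le.1 h)] with s hs hs'
          exact absurd hs'.2 (not_le.2 hs)
        exact this.mono fun _ h => h.elim
    · by_cases h : 1 / 2 ≤ t
      · rw [concat_right e h] at hp ⊢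
        have := (tendsto_reparam (by fun_prop) mapsTo_right t).eventually
          (hδ.eventually (mapsTo_right ⟨h, ht.2⟩) hu hp)
        filter_upwards [this, self_mem_nhdsWithin] with s hs hs'
        rw [concat_right e hs'.1, hs]
      · have : ∀ᶠ s in 𝓝[Icc (1 / 2 : ℝ) 1] t, False := by
          rw [eventually_nhdsWithin_iff]
          filter_upwards [Iio_mem_nhds (not_le.1 h)] with s hs hs'
          exact absurd hs'.1 (not_le.2 hs)
        exact this.mono fun _ h => h.elim

theorem IsHolonomyMap.one (F : TransverselyHolomorphicFoliation ℓ M) {p : M}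
    (D : F.TransverseDisc p) : F.IsHolonomyMap D id := by
  refine ⟨Metric.ball 0 1, Metric.ball_mem_nhds _ one_pos, fun z _ => D.toFun z, ?_,
    fun z _ => ⟨IsLeafwise.const F _, rfl, rfl⟩⟩
  exact D.smooth.continuousOn.comp continuousOn_fst fun x hx => hx.1

theorem IsHolonomyMap.mul {F : TransverselyHolomorphicFoliation ℓ M} {p : M}
    {D : F.TransverseDisc p} {f g : HolMap} (hf : F.IsHolonomyMap D f.fn)
    (hg : F.IsHolonomyMap D g.fn) : F.IsHolonomyMap D (f * g).fn := by
  obtain ⟨V, hV, H, hH, h⟩ := hf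
  obtain ⟨W, hW, K, hK, k⟩ := hg
  obtain ⟨C, hC, hgC⟩ : ∃ C ∈ 𝓝 (0 : ℂ), ContinuousOn g.fn C :=
    ⟨_, g.analyticAt.eventually_analyticAt,
      fun z hz => (show AnalyticAt ℂ g.fn z from hz).continuousAt.continuousWithinAt⟩
  set Y : Set ℂ := W ∩ (C ∩ g.fn ⁻¹' V)
  have hY : Y ∈ 𝓝 (0 : ℂ) := inter_mem hW (inter_mem hC (g.tendsto hV))
  have e : ∀ z ∈ Y, K z 1 = H (g.fn z) 0 := fun z hz => by
    rw [(k z hz.1).2.2, (h _ hz.2.2).2.1]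
  refine ⟨Y, hY, fun z => concat (K z) (H (g.fn z)), ?_, fun z hz => ⟨?_, ?_, ?_⟩⟩
  · rw [Icc_halves, prod_union]
    have hl : ContinuousOn (fun x : ℂ × ℝ => concat (K x.1) (H (g.fn x.1)) x.2)
        (Y ×ˢ Icc (0 : ℝ) (1 / 2)) := by
      refine ContinuousOn.congr (f := fun x : ℂ × ℝ => K x.1 (2 * x.2)) ?_
        fun x hx => concat_left _ _ hx.2.2
      exact hK.comp (f := fun x : ℂ × ℝ => (x.1, 2 * x.2)) (by fun_prop)
        fun x hx => ⟨hx.1.1, mapsTo_left hx.2⟩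
    have hr : ContinuousOn (fun x : ℂ × ℝ => concat (K x.1) (H (g.fn x.1)) x.2)
        (Y ×ˢ Icc (1 / 2 : ℝ) 1) := by
      refine ContinuousOn.congr (f := fun x : ℂ × ℝ => H (g.fn x.1) (2 * x.2 - 1)) ?_
        fun x hx => concat_right (e x.1 hx.1) hx.2.1
      refine hH.comp (f := fun x : ℂ × ℝ => (g.fn x.1, 2 * x.2 - 1)) ?_
        fun x hx => ⟨hx.1.2.2, mapsTo_right hx.2⟩
      exact (hgC.comp continuousOn_fst fun x hx => hx.1.2.1).prodMk (by fun_prop)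
    intro x hx
    rw [ContinuousWithinAt, nhdsWithin_union, tendsto_sup]
    have key : ∀ S : Set ℝ, IsClosed S →
        ContinuousOn (fun x : ℂ × ℝ => concat (K x.1) (H (g.fn x.1)) x.2) (Y ×ˢ S) →
        x.1 ∈ Y → Tendsto (fun x : ℂ × ℝ => concat (K x.1) (H (g.fn x.1)) x.2)
          (𝓝[Y ×ˢ S] x) (𝓝 (concat (K x.1) (H (g.fn x.1)) x.2)) := by
      intro S hS hc hx1
      by_cases hxS : x.2 ∈ S
      · exact hc x ⟨hx1, hxS⟩
      · have : 𝓝[Y ×ˢ S] x = ⊥ := by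
          rw [← notMem_closure_iff_nhdsWithin_eq_bot, closure_prod_eq, hS.closure_eq]
          exact fun hh => hxS hh.2
        rw [this]
        exact tendsto_bot
    have hx1 : x.1 ∈ Y := by
      rcases hx with hx | hx <;> exact hx.1
    exact ⟨key _ isClosed_Icc hl hx1, key _ isClosed_Icc hr hx1⟩
  · exact (k z hz.1).1.concat (h _ hz.2.2).1 (e z hz)
  · change concat (K z) (H (g.fn z)) 0 = _
    rw [concat_left _ _ (by norm_num), mul_zero, (k z hz.1).2.1]
  · change concat (K z) (H (g.fn z)) 1 = _
    rw [concat_right (e z hz) (by norm_num)]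
    norm_num
    rw [(h _ hz.2.2).2.2]
    rfl

theorem IsHolonomyMap.inv {F : TransverselyHolomorphicFoliation ℓ M} {p : M}
    {D : F.TransverseDisc p} {f g : HolMap} (hf : F.IsHolonomyMap D f.fn)
    (hfg : f.fn ∘ g.fn =ᶠ[𝓝 0] id) : F.IsHolonomyMap D g.fn := by
  obtain ⟨V, hV, H, hH, h⟩ := hf
  obtain ⟨C, hC, hgC⟩ : ∃ C ∈ 𝓝 (0 : ℂ), ContinuousOn g.fn C :=
    ⟨_, g.analyticAt.eventually_analyticAt,
      fun z hz => (show AnalyticAt ℂ g.fn z from hz).continuousAt.continuousWithinAt⟩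
  refine ⟨{z | (f.fn ∘ g.fn) z = id z} ∩ (C ∩ g.fn ⁻¹' V),
    inter_mem hfg (inter_mem hC (g.tendsto hV)), fun z t => H (g.fn z) (1 - t), ?_,
    fun z hz => ⟨(h _ hz.2.2).1.reverse, ?_, ?_⟩⟩
  · refine hH.comp (f := fun x : ℂ × ℝ => (g.fn x.1, 1 - x.2)) ?_
      fun x hx => ⟨hx.1.2.2, mapsTo_reverse hx.2⟩
    exact (hgC.comp continuousOn_fst fun x hx => hx.1.2.1).prodMk (by fun_prop)
  · have hz1 : f.fn (g.fn z) = z := hz.1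
    simp only [sub_zero]
    rw [(h _ hz.2.2).2.2, hz1]
  · simp only [sub_self]
    exact (h _ hz.2.2).2.1

/-- The holonomy group of the leaf through `p`, on the transverse disc `D` at `p`: the subgroup of
`Diff(ℂ, 0)` of the germs of the holonomy maps on `D`. -/
def holonomyGroup (F : TransverselyHolomorphicFoliation ℓ M) {p : M} (D : F.TransverseDisc p) :
    Subgroup DiffGerm where
  carrier := {φ | ∃ f : HolMap, φ.IsRep f ∧ F.IsHolonomyMap D f.fn}
  one_mem' := ⟨1, rfl, IsHolonomyMap.one F D⟩
  mul_mem' := by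
    rintro φ ψ ⟨f, hf, hf'⟩ ⟨g, hg, hg'⟩
    exact ⟨f * g, congrArg₂ (· * ·) hf hg, hf'.mul hg'⟩
  inv_mem' := by
    rintro φ ⟨f, hf, hf'⟩
    obtain ⟨g, hg⟩ := sameGermAtZero.mk'_surjective
      ((φ⁻¹ : DiffGerm) : sameGermAtZero.Quotient)
    refine ⟨g, hg, hf'.inv ?_⟩
    have h1 : ((f * g : HolMap) : sameGermAtZero.Quotient)
        = ((1 : HolMap) : sameGermAtZero.Quotient) := by
      have : ((f : sameGermAtZero.Quotient)) * (g : sameGermAtZero.Quotient) = 1 := by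
        rw [show (g : sameGermAtZero.Quotient) = _ from hg,
          show (f : sameGermAtZero.Quotient) = _ from hf, Units.mul_inv]
      exact this
    exact sameGermAtZero.eq.1 h1

end TransverselyHolomorphicFoliation

end Foliation

/-! An affine chart `w` off `Λ` restricts to the disc `D` as a holomorphic function with nonzero
derivative, and `w'' / w'` is the same for `w` and `a w + b`. Since `Λ` meets `D` near its centre
only in the centre, these quotients glue to a holomorphic `η` on a punctured neighbourhood of `0`.
Leafwise paths starting off `Λ` stay off `Λ` and transport affine charts to affine charts, so
holonomy maps preserve the connection `d + η dz` (`exists_connection`). What remains concerns a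
group `H` of germs preserving some `η`; no control of the singularity of `η` at `0` is needed
(`isSolvable_of_preservesConnection`).

Commutators in `H` are tangent to the identity. Germs tangent to the identity preserve every
direction at `0`, and near the ray through `c` the connection has a flat coordinate `W c`, on which
they act by affine maps (`IsFlatCoordinate.exists_affine`). Commutators of affine maps are
translations, and commutators of translations are trivial. Three commutator steps thus lead to germs
that leave every `W c` invariant, and it suffices that these commute.

Nontrivial germs of this last kind all have the same order of tangency. Otherwise let `f` have order
`k` and `h` a higher one, and let `z_n = f^n(z_0)` tend to `0` along an attracting direction of `f`.
The points `y_n = f^{-n}(h(z_n))` differ from `z_0` and satisfy `W(y_n) = W(z_0)`. Under `f`,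
distances between nearby points shrink roughly like `|z|^(k+1)`, whereas `|h(z_n) - z_n|` is
`O(|z_n|^(k+2))`; hence `y_n → z_0`, against the local injectivity of `W`
(`IsAttractingDirection.false_of_invariant`). As the commutator of two germs of order `k` has order
greater than `k` unless it is trivial (`lt_order_commutator`), it is trivial. -/

/-- The affine connection `d + η dz` on a punctured neighbourhood of `0` is preserved by `f`. -/
def PreservesConnection (η f : ℂ → ℂ) : Prop :=
  ∀ᶠ z in 𝓝[≠] (0 : ℂ), η (f z) * deriv f z ^ 2 + deriv (deriv f) z = η z * deriv f z

/-! ### From the affine structure off `Λ` to an invariant connection on the punctured disc. -/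

section Geometry

variable {ℓ : ℕ} {M : Type*} [TopologicalSpace M]
  [ChartedSpace (EuclideanSpace ℝ (Fin (ℓ + 2))) M]

namespace TransverselyHolomorphicFoliation

variable {F : TransverselyHolomorphicFoliation ℓ M}

theorem continuousAt_chart {u : Opens M × (M → ℂ)} (hu : u ∈ F.atlas) {p : M} (hp : p ∈ u.1) :
    ContinuousAt u.2 p :=
  (F.smooth u hu).continuousOn.continuousAt (u.1.isOpen.mem_nhds hp)

theorem TransverseDisc.continuousAt {p : M} (D : F.TransverseDisc p) {z : ℂ}
    (hz : z ∈ Metric.ball (0 : ℂ) 1) : ContinuousAt D.toFun z :=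
  D.smooth.continuousOn.continuousAt (Metric.isOpen_ball.mem_nhds hz)

/-- A compact curve meets a transverse disc only at its centre, near the centre. -/
theorem IsCompactCurve.eventually_notMem {Λ : Set M} (hΛ : F.IsCompactCurve Λ) {p : M}
    (hp : p ∈ Λ) (D : F.TransverseDisc p) : ∀ᶠ z in 𝓝[≠] (0 : ℂ), D.toFun z ∉ Λ := by
  obtain ⟨U, f, hpU, hf, hU⟩ := hΛ.2.2 p hp
  obtain ⟨u, hu, hpu, g, hg, hfg⟩ := hf p hpU
  have h0 : (0 : ℂ) ∈ Metric.ball (0 : ℂ) 1 := Metric.mem_ball_self one_pos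
  have hD : Tendsto D.toFun (𝓝 0) (𝓝 p) := by
    have := (D.continuousAt h0).tendsto
    rwa [D.map_zero] at this
  obtain ⟨h1, h2⟩ := D.transverse 0 h0 u hu (by rwa [D.map_zero])
  have e0 : (u.2 ∘ D.toFun) 0 = u.2 p := by simp [D.map_zero]
  have hfD : f ∘ D.toFun =ᶠ[𝓝 0] g ∘ (u.2 ∘ D.toFun) := hD.eventually hfg
  have hU' : ∀ᶠ z in 𝓝 (0 : ℂ), D.toFun z ∈ U := hD.eventually (U.isOpen.mem_nhds hpU)
  rcases AnalyticAt.eventually_eq_zero_or_eventually_ne_zero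
    (AnalyticAt.comp (by rwa [e0]) h1 : AnalyticAt ℂ (g ∘ (u.2 ∘ D.toFun)) 0) with h | h
  -- If the function vanished along the disc, which is open for the transverse coordinate, it would
  -- vanish on a neighbourhood of `p` in `M`, and `Λ` would have interior.
  · exfalso
    have hg0 : ∀ᶠ y in 𝓝 (u.2 p), g y = 0 := by
      rw [← e0, ← h1.hasStrictDerivAt.map_nhds_eq h2]
      exact h
    have : Λ ∈ 𝓝 p := by
      filter_upwards [hfg, (continuousAt_chart hu hpu).eventually hg0, U.isOpen.mem_nhds hpU]
        with q hq hq' hqU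
      have : q ∈ Λ ∩ U := by
        rw [hU]
        exact ⟨hqU, hq.trans hq'⟩
      exact this.1
    have := mem_interior_iff_mem_nhds.2 this
    rw [hΛ.2.1] at this
    exact this
  · filter_upwards [h, nhdsWithin_le_nhds hfD, nhdsWithin_le_nhds hU'] with z hz hz' hzU hzΛ
    have : D.toFun z ∈ Λ ∩ U := ⟨hzΛ, hzU⟩
    rw [hU] at this
    exact hz (hz'.symm.trans this.2)

/-- A leafwise path that starts outside a compact curve stays outside. -/
theorem IsLeafwise.notMem [T2Space M] {Λ : Set M} (hΛ : F.IsCompactCurve Λ) {γ : ℝ → M}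
    (hγ : F.IsLeafwise γ) (h0 : γ 0 ∉ Λ) {t : ℝ} (ht : t ∈ Icc (0 : ℝ) 1) : γ t ∉ Λ := by
  -- Membership in `Λ` is locally constant in time: near `Λ` it depends only on the transverse
  -- coordinate, and off `Λ` it is an open condition because `Λ` is closed.
  have key : ∀ s ∈ Icc (0 : ℝ) 1, ∀ᶠ r in 𝓝[Icc (0 : ℝ) 1] s, (γ s ∈ Λ ↔ γ r ∈ Λ) := by
    intro s hs
    by_cases hsΛ : γ s ∈ Λ
    · obtain ⟨U, f, hpU, hf, hU⟩ := hΛ.2.2 _ hsΛ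
      obtain ⟨u, hu, hpu, g, hg, hfg⟩ := hf _ hpU
      have hfs : f (γ s) = 0 := by
        have : γ s ∈ Λ ∩ U := ⟨hsΛ, hpU⟩
        rw [hU] at this
        exact this.2
      filter_upwards [hγ.eventually hs hu hpu, (hγ.1 s hs).eventually hfg,
        (hγ.1 s hs).eventually (U.isOpen.mem_nhds hpU)] with r hr hr' hrU
      have : γ r ∈ Λ ∩ U := by
        rw [hU]
        refine ⟨hrU, ?_⟩
        rw [hr', Function.comp_apply, hr, ← hfs, hfg.self_of_nhds, Function.comp_apply]
      exact iff_of_true hsΛ this.1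
    · filter_upwards [(hγ.1 s hs).eventually (hΛ.1.isClosed.isOpen_compl.mem_nhds hsΛ)] with r hr
      exact iff_of_false hsΛ hr
  have := isPreconnected_Icc.induction₂ (fun s r => (γ s ∈ Λ ↔ γ r ∈ Λ)) key
    (fun _ _ _ _ _ _ h h' => h.trans h') (fun _ _ _ _ h => h.symm)
    (show (0 : ℝ) ∈ Icc (0 : ℝ) 1 by simp) ht
  exact fun h => h0 (this.2 h)

/-- A cover of `W` by transversal submersions which differ by locally constant affine maps. -/
structure IsAffineAtlas (F : TransverselyHolomorphicFoliation ℓ M) (W : Set M)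
    (A : Set (Opens M × (M → ℂ))) : Prop where
  covers : ∀ p ∈ W, ∃ u ∈ A, p ∈ u.1
  submersion : ∀ u ∈ A, F.IsTransverseSubmersionOn u.2 u.1
  affine : ∀ u ∈ A, ∀ v ∈ A, ∀ p, p ∈ u.1 → p ∈ v.1 →
    ∃ a b : ℂ, a ≠ 0 ∧ ∀ᶠ q in 𝓝 p, v.2 q = a * u.2 q + b

theorem IsTransverselyAffineOn.exists_isAffineAtlas {W : Set M}
    (h : F.IsTransverselyAffineOn W) : ∃ A, F.IsAffineAtlas W A := by
  obtain ⟨A, h1, h2, h3⟩ := h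
  refine ⟨A, h1, fun u hu => (h2 u hu).2, fun u hu v hv p hpu hpv => ?_⟩
  obtain ⟨a, b, ha, hb, hab⟩ := h3 u hu v hv
  let p' : (u.1 ⊓ v.1 : Opens M) := ⟨p, hpu, hpv⟩
  refine ⟨a p', b p', (hab p').1, ?_⟩
  have h4 : ∀ᶠ q : (u.1 ⊓ v.1 : Opens M) in 𝓝 p', v.2 q = a p' * u.2 q + b p' := by
    filter_upwards [ha.eventually_eq p', hb.eventually_eq p'] with q hq hq'
    rw [(hab q).2, hq, hq']
  have h5 : map ((↑) : (u.1 ⊓ v.1 : Opens M) → M) (𝓝 p') = 𝓝 p :=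
    (u.1 ⊓ v.1).isOpen.isOpenEmbedding_subtypeVal.map_nhds_eq p'
  rw [← h5]
  exact h4

namespace IsAffineAtlas

variable {W : Set M} {A : Set (Opens M × (M → ℂ))}

theorem transverse (hA : F.IsAffineAtlas W A) {p : M} (D : F.TransverseDisc p) {v}
    (hv : v ∈ A) {z : ℂ} (hz : z ∈ Metric.ball (0 : ℂ) 1) (hzv : D.toFun z ∈ v.1) :
    AnalyticAt ℂ (v.2 ∘ D.toFun) z ∧ deriv (v.2 ∘ D.toFun) z ≠ 0 := by
  obtain ⟨u, hu, hzu, g, hg, hg', hvg⟩ := hA.submersion v hv _ hzv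
  obtain ⟨h1, h2⟩ := D.transverse z hz u hu hzu
  have e : v.2 ∘ D.toFun =ᶠ[𝓝 z] g ∘ (u.2 ∘ D.toFun) := (D.continuousAt hz).eventually hvg
  constructor
  · exact (AnalyticAt.comp (f := u.2 ∘ D.toFun) hg h1).congr e.symm
  · rw [e.deriv_eq, deriv_comp z hg.differentiableAt h1.differentiableAt]
    exact mul_ne_zero hg' h2

/-- An affine chart is locally constant in time along a continuous family of leafwise paths. -/
theorem eventually_constant (hA : F.IsAffineAtlas W A) {H : ℂ → ℝ → M} {V : Set ℂ} {z₀ : ℂ}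
    (hV : V ∈ 𝓝 z₀) (hH : ContinuousOn (fun x : ℂ × ℝ => H x.1 x.2) (V ×ˢ Icc 0 1))
    (hl : ∀ z ∈ V, F.IsLeafwise (H z)) {t : ℝ} (ht : t ∈ Icc (0 : ℝ) 1) {v} (hv : v ∈ A)
    (htv : H z₀ t ∈ v.1) :
    ∀ᶠ s in 𝓝[Icc (0 : ℝ) 1] t, H z₀ s ∈ v.1 ∧ ∀ᶠ z in 𝓝 z₀, v.2 (H z s) = v.2 (H z t) := by
  obtain ⟨u, hu, hpu, g, -, -, hvg⟩ := hA.submersion v hv _ htv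
  have h1 : ∀ᶠ q in 𝓝 (H z₀ t), q ∈ v.1 ∧ q ∈ u.1 ∧ v.2 q = (g ∘ u.2) q :=
    by
    filter_upwards [v.1.isOpen.mem_nhds htv, u.1.isOpen.mem_nhds hpu, hvg] with q h h' h''
    exact ⟨h, h', h''⟩
  have h2 := (hH (z₀, t) ⟨mem_of_mem_nhds hV, ht⟩).eventually h1
  -- A product neighbourhood provides one time interval that serves all `z` near `z₀`; on it the
  -- foliation coordinate is constant along each path.
  rw [nhdsWithin_prod_eq, nhdsWithin_eq_nhds.2 hV, eventually_prod_iff] at h2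
  obtain ⟨P, hP, Q, hQ, hPQ⟩ := h2
  obtain ⟨ε, hε, hεQ⟩ := Metric.nhdsWithin_basis_ball.mem_iff.1 hQ
  have hmem : Metric.ball t ε ∩ Icc (0 : ℝ) 1 ∈ 𝓝[Icc (0 : ℝ) 1] t :=
    inter_mem (nhdsWithin_le_nhds (Metric.ball_mem_nhds _ hε)) self_mem_nhdsWithin
  filter_upwards [hmem] with s hs
  refine ⟨(hPQ hP.self_of_nhds (hεQ hs)).1, ?_⟩
  filter_upwards [hP, hV] with z hz hzV
  have hconv : IsPreconnected (Metric.ball t ε ∩ Icc (0 : ℝ) 1) :=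
    ((convex_ball t ε).inter (convex_Icc 0 1)).isPreconnected
  have h3 : u.2 (H z s) = u.2 (H z t) := by
    refine hconv.induction₂ (fun r r' => u.2 (H z r) = u.2 (H z r')) (fun r hr => ?_)
      (fun _ _ _ _ _ _ h h' => h.trans h') (fun _ _ _ _ h => h.symm) hs
      ⟨Metric.mem_ball_self hε, ht⟩
    have := (hl z hzV).eventually hr.2 hu (hPQ hz (hεQ hr)).2.1
    filter_upwards [nhdsWithin_mono r inter_subset_right this] with r' hr'
    exact hr'.symm
  rw [(hPQ hz (hεQ hs)).2.2, (hPQ hz (hεQ ⟨Metric.mem_ball_self hε, ht⟩)).2.2,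
    Function.comp_apply, h3, Function.comp_apply]

/-- Affine charts are transported to affine charts along a continuous family of leafwise paths. -/
theorem transport (hA : F.IsAffineAtlas W A) {H : ℂ → ℝ → M} {V : Set ℂ} {z₀ : ℂ}
    (hV : V ∈ 𝓝 z₀) (hH : ContinuousOn (fun x : ℂ × ℝ => H x.1 x.2) (V ×ˢ Icc 0 1))
    (hl : ∀ z ∈ V, F.IsLeafwise (H z)) (hW : ∀ t ∈ Icc (0 : ℝ) 1, H z₀ t ∈ W)
    {u v} (hu : u ∈ A) (hv : v ∈ A) (h0 : H z₀ 0 ∈ u.1) (h1 : H z₀ 1 ∈ v.1) :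
    ∃ a b : ℂ, a ≠ 0 ∧ ∀ᶠ z in 𝓝 z₀, v.2 (H z 1) = a * u.2 (H z 0) + b := by
  -- Quantifying over all charts at `H z₀ t` makes the property independent of a choice, so that it
  -- can be compared at nearby times and spread over `[0, 1]` by connectedness.
  let Q : ℝ → Prop := fun t => ∀ v ∈ A, H z₀ t ∈ v.1 →
    ∃ a b : ℂ, a ≠ 0 ∧ ∀ᶠ z in 𝓝 z₀, v.2 (H z t) = a * u.2 (H z 0) + b
  have hc : ∀ t ∈ Icc (0 : ℝ) 1, ContinuousAt (fun z => H z t) z₀ := by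
    intro t ht
    have : ContinuousOn (fun z => H z t) V :=
      hH.comp (f := fun z => (z, t)) (by fun_prop) fun z hz => ⟨hz, ht⟩
    exact this.continuousAt hV
  have change : ∀ t ∈ Icc (0 : ℝ) 1, ∀ w ∈ A, H z₀ t ∈ w.1 →
      (∃ a b : ℂ, a ≠ 0 ∧ ∀ᶠ z in 𝓝 z₀, w.2 (H z t) = a * u.2 (H z 0) + b) → Q t := by
    rintro t ht w hw htw ⟨a, b, ha, hab⟩ v hv htv
    obtain ⟨a', b', ha', hab'⟩ := hA.affine w hw v hv _ htw htv
    refine ⟨a' * a, a' * b + b', mul_ne_zero ha' ha, ?_⟩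
    filter_upwards [hab, (hc t ht).eventually hab'] with z hz hz'
    rw [hz', hz]
    ring
  have key : ∀ t ∈ Icc (0 : ℝ) 1, ∀ᶠ s in 𝓝[Icc (0 : ℝ) 1] t, (Q t ↔ Q s) := by
    intro t ht
    obtain ⟨w, hw, htw⟩ := hA.covers _ (hW t ht)
    filter_upwards [hA.eventually_constant hV hH hl ht hw htw, self_mem_nhdsWithin] with s hs hsI
    constructor
    · intro h
      obtain ⟨a, b, ha, hab⟩ := h w hw htw
      refine change s hsI w hw hs.1 ⟨a, b, ha, ?_⟩
      filter_upwards [hab, hs.2] with z hz hz'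
      rw [hz', hz]
    · intro h
      obtain ⟨a, b, ha, hab⟩ := h w hw hs.1
      refine change t ht w hw htw ⟨a, b, ha, ?_⟩
      filter_upwards [hab, hs.2] with z hz hz'
      rw [← hz', hz]
  have hQ := isPreconnected_Icc.induction₂ (fun s r => (Q s ↔ Q r)) key
    (fun _ _ _ _ _ _ h h' => h.trans h') (fun _ _ _ _ h => h.symm)
    (show (0 : ℝ) ∈ Icc (0 : ℝ) 1 by simp) (show (1 : ℝ) ∈ Icc (0 : ℝ) 1 by simp)
  refine hQ.1 (change 0 (by simp) u hu h0 ⟨1, 0, one_ne_zero, ?_⟩) v hv h1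
  exact Eventually.of_forall fun z => by ring

end IsAffineAtlas

/-- The affine structure induces on the punctured transverse disc an affine connection which is
preserved by the holonomy maps. -/
theorem exists_connection [T2Space M] {Λ : Set M} (hΛ : F.IsCompactCurve Λ)
    (haff : F.IsTransverselyAffineOn Λᶜ) {p : M} (hp : p ∈ Λ) (D : F.TransverseDisc p) :
    ∃ η : ℂ → ℂ, (∀ᶠ z in 𝓝[≠] (0 : ℂ), AnalyticAt ℂ η z) ∧
      ∀ f : HolMap, deriv f.fn 0 ≠ 0 → F.IsHolonomyMap D f.fn → PreservesConnection η f.fn := by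
  obtain ⟨A, hA⟩ := haff.exists_isAffineAtlas
  have hcov : ∀ z : ℂ, ∃ v : Opens M × (M → ℂ), D.toFun z ∉ Λ → v ∈ A ∧ D.toFun z ∈ v.1 := by
    intro z
    by_cases h : D.toFun z ∈ Λ
    · exact ⟨⟨⊤, fun _ => 0⟩, fun h' => absurd h h'⟩
    · obtain ⟨v, hv, hv'⟩ := hA.covers _ h
      exact ⟨v, fun _ => ⟨hv, hv'⟩⟩
  choose v hv using hcov
  let w : ℂ → ℂ → ℂ := fun z => (v z).2 ∘ D.toFun
  -- The chart `v z` is chosen separately at each point; `hη` shows that any affine chart gives the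
  -- same value, whence analyticity.
  let η : ℂ → ℂ := fun z => deriv (deriv (w z)) z / deriv (w z) z
  have hη : ∀ z ∈ Metric.ball (0 : ℂ) 1, D.toFun z ∉ Λ → ∀ u ∈ A, D.toFun z ∈ u.1 →
      η z = deriv (deriv (u.2 ∘ D.toFun)) z / deriv (u.2 ∘ D.toFun) z := by
    intro z hz hzΛ u hu hzu
    obtain ⟨a, b, ha, hab⟩ := hA.affine _ (hv z hzΛ).1 u hu _ (hv z hzΛ).2 hzu
    have e : u.2 ∘ D.toFun =ᶠ[𝓝 z] fun y => a * w z y + b := (D.continuousAt hz).eventually hab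
    have e1 : deriv (u.2 ∘ D.toFun) =ᶠ[𝓝 z] fun y => a * deriv (w z) y := by
      refine e.deriv.trans (Eventually.of_forall fun y => ?_)
      simp
    have e2 : deriv (deriv (u.2 ∘ D.toFun)) z = a * deriv (deriv (w z)) z := by
      rw [e1.deriv_eq]
      simp
    rw [e2, e1.self_of_nhds, mul_div_mul_left _ _ ha]
  have hball : ∀ᶠ z in 𝓝[≠] (0 : ℂ), z ∈ Metric.ball (0 : ℂ) 1 :=
    nhdsWithin_le_nhds (Metric.ball_mem_nhds _ one_pos)
  have hN := hΛ.eventually_notMem hp D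
  refine ⟨η, ?_, fun f hf' hf => ?_⟩
  · filter_upwards [hball, hN] with z hz hzΛ
    obtain ⟨h1, h2⟩ := hA.transverse D (hv z hzΛ).1 hz (hv z hzΛ).2
    refine (h1.deriv.deriv.div h1.deriv h2).congr ?_
    filter_upwards [Metric.isOpen_ball.mem_nhds hz,
      (D.continuousAt hz).eventually (hΛ.1.isClosed.isOpen_compl.mem_nhds hzΛ),
      (D.continuousAt hz).eventually ((v z).1.isOpen.mem_nhds (hv z hzΛ).2)] with y hy hyΛ hyv
    exact (hη y hy hyΛ _ (hv z hzΛ).1 hyv).symm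
  · obtain ⟨V, hV, H, hH, h⟩ := hf
    have hfball : ∀ᶠ z in 𝓝[≠] (0 : ℂ), f.fn z ∈ Metric.ball (0 : ℂ) 1 :=
      nhdsWithin_le_nhds (f.tendsto.eventually (Metric.ball_mem_nhds _ one_pos))
    have hV' : ∀ᶠ z in 𝓝[≠] (0 : ℂ), V ∈ 𝓝 z :=
      nhdsWithin_le_nhds (eventually_mem_nhds_iff.2 hV)
    filter_upwards [hball, hN, hfball, hV',
      nhdsWithin_le_nhds f.analyticAt.eventually_analyticAt,
      nhdsWithin_le_nhds (f.analyticAt.deriv.continuousAt.eventually_ne hf')]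
      with z hz hzΛ hfz hVz hfan hfz'
    have hl : ∀ t ∈ Icc (0 : ℝ) 1, H z t ∉ Λ := by
      intro t ht
      have hzV := h z (mem_of_mem_nhds hVz)
      exact hzV.1.notMem hΛ (by rwa [hzV.2.1]) ht
    have hfΛ : D.toFun (f.fn z) ∉ Λ := by
      rw [← (h z (mem_of_mem_nhds hVz)).2.2]
      exact hl 1 (by simp)
    obtain ⟨a, b, ha, hab⟩ := hA.transport hVz hH (fun z hz => (h z hz).1) hl
      (hv z hzΛ).1 (hv _ hfΛ).1 (by rw [(h z (mem_of_mem_nhds hVz)).2.1]; exact (hv z hzΛ).2)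
      (by rw [(h z (mem_of_mem_nhds hVz)).2.2]; exact (hv _ hfΛ).2)
    obtain ⟨h1, h2⟩ := hA.transverse D (hv z hzΛ).1 hz (hv z hzΛ).2
    obtain ⟨h3, h4⟩ := hA.transverse D (hv _ hfΛ).1 hfz (hv _ hfΛ).2
    change AnalyticAt ℂ (w (f.fn z)) (f.fn z) at h3
    change deriv (w (f.fn z)) (f.fn z) ≠ 0 at h4
    -- The holonomy map reads as an affine map in the affine charts at `z` and `f z`. Its first and
    -- second derivatives, `e1` and `e2`, give the invariance of `η` once the constant `a` is
    -- eliminated.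
    have e : (fun y => w (f.fn z) (f.fn y)) =ᶠ[𝓝 z] fun y => a * w z y + b := by
      filter_upwards [hab, hVz] with y hy hyV
      rw [(h y hyV).2.1, (h y hyV).2.2] at hy
      exact hy
    have e1 : (fun y => deriv (w (f.fn z)) (f.fn y) * deriv f.fn y)
        =ᶠ[𝓝 z] fun y => a * deriv (w z) y := by
      have e' : deriv (fun y => w (f.fn z) (f.fn y)) =ᶠ[𝓝 z] fun y => a * deriv (w z) y := by
        refine e.deriv.trans (Eventually.of_forall fun y => ?_)
        simp
      filter_upwards [e', hfan.eventually_analyticAt,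
        hfan.continuousAt.eventually h3.eventually_analyticAt] with y hy hy1 hy2
      rw [← hy]
      exact (deriv_comp y hy2.differentiableAt hy1.differentiableAt).symm
    have e2 : deriv (deriv (w (f.fn z))) (f.fn z) * deriv f.fn z * deriv f.fn z
        + deriv (w (f.fn z)) (f.fn z) * deriv (deriv f.fn) z = a * deriv (deriv (w z)) z := by
      have hd := ((h3.deriv.differentiableAt.hasDerivAt.comp z hfan.differentiableAt.hasDerivAt).mul
        hfan.deriv.differentiableAt.hasDerivAt).deriv
      have hd' := e1.deriv_eq
      have hd'' : deriv (fun y => a * deriv (w z) y) z = a * deriv (deriv (w z)) z := by simp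
      rw [hd''] at hd'
      rw [← hd']
      exact hd.symm
    have e1z := e1.self_of_nhds
    simp only at e1z
    change deriv (deriv (w (f.fn z))) (f.fn z) / deriv (w (f.fn z)) (f.fn z) * deriv f.fn z ^ 2
      + deriv (deriv f.fn) z = deriv (deriv (w z)) z / deriv (w z) z * deriv f.fn z
    change deriv (w z) z ≠ 0 at h2
    field_simp
    apply mul_left_cancel₀ ha
    linear_combination (deriv f.fn z * deriv (w (f.fn z)) (f.fn z)) * e2 -
      (deriv (deriv (w (f.fn z))) (f.fn z) * deriv f.fn z ^ 2 +
        deriv (deriv f.fn) z * deriv (w (f.fn z)) (f.fn z)) * e1z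

end TransverselyHolomorphicFoliation

end Geometry

/-! ### Germs along a ray -/

/-- The filter of punctured sectors of small radius and small opening around the ray through `c`. -/
noncomputable def rayFilter (c : ℂ) : Filter ℂ :=
  comap (fun z : ℂ => (‖z‖, Complex.arg (z / c))) (𝓝[>] 0 ×ˢ 𝓝 0)

/-- The sector of radius and half-opening `ε` around the ray through `c`. -/
def raySector (c : ℂ) (ε : ℝ) : Set ℂ :=
  {z | (0 < ‖z‖ ∧ ‖z‖ < ε) ∧ |Complex.arg (z / c)| < ε}

theorem rayFilter_hasBasis (c : ℂ) : (rayFilter c).HasBasis (fun ε : ℝ => 0 < ε) (raySector c) := by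
  have h1 : (𝓝[>] (0 : ℝ) ×ˢ 𝓝 (0 : ℝ)).HasBasis (fun ε : ℝ => 0 < ε)
      fun ε => Ioo 0 ε ×ˢ {t | |t| < ε} :=
    (nhdsGT_basis (0 : ℝ)).prod_same_index (nhds_basis_zero_abs_lt ℝ) (fun {i j} hi hj =>
      ⟨min i j, lt_min hi hj, Ioo_subset_Ioo_right (min_le_left _ _),
        fun t (ht : |t| < min i j) => ht.trans_le (min_le_right _ _)⟩)
  exact h1.comap _

theorem raySector_mem {c : ℂ} {ε : ℝ} (hε : 0 < ε) : raySector c ε ∈ rayFilter c :=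
  (rayFilter_hasBasis c).mem_of_mem hε

theorem rayFilter_le (c : ℂ) : rayFilter c ≤ 𝓝[≠] 0 := by
  have h : Tendsto (fun z : ℂ => (‖z‖, Complex.arg (z / c))) (rayFilter c) (𝓝[>] 0 ×ˢ 𝓝 0) :=
    tendsto_comap
  have h1 : Tendsto (fun z : ℂ => ‖z‖) (rayFilter c) (𝓝[>] 0) := tendsto_fst.comp h
  refine tendsto_id'.1 (tendsto_nhdsWithin_iff.2 ⟨?_, ?_⟩)
  · exact tendsto_zero_iff_norm_tendsto_zero.2 (h1.mono_right nhdsWithin_le_nhds)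
  · filter_upwards [h1.eventually self_mem_nhdsWithin] with z hz
    exact norm_pos_iff.1 hz

/-- Polar coordinates exhibit the sector as the image of a rectangle, hence connected. The bound `ε
≤ 1` keeps angles inside `(-π, π]`, so `arg` does not wrap around. -/
theorem raySector_eq {c : ℂ} (hc : c ≠ 0) {ε : ℝ} (hε : ε ≤ 1) :
    raySector c ε = (fun x : ℝ × ℝ => (x.1 : ℂ) * Complex.exp (x.2 * Complex.I) * c) ''
      (Ioo 0 (ε / ‖c‖) ×ˢ Ioo (-ε) ε) := by
  have hc' : 0 < ‖c‖ := norm_pos_iff.2 hc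
  ext z
  constructor
  · rintro ⟨⟨h1, h2⟩, h3⟩
    refine ⟨(‖z / c‖, Complex.arg (z / c)), ⟨⟨?_, ?_⟩, abs_lt.1 h3⟩, ?_⟩
    · rw [norm_div]
      positivity
    · rw [norm_div]
      exact (div_lt_div_iff_of_pos_right hc').2 h2
    · simp only [Complex.norm_mul_exp_arg_mul_I]
      field_simp
  · rintro ⟨⟨r, θ⟩, ⟨⟨h1, h2⟩, h3, h4⟩, rfl⟩
    simp only at h1 h2 h3 h4
    have hn : ‖(r : ℂ) * Complex.exp (θ * Complex.I) * c‖ = r * ‖c‖ := by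
      simp [abs_of_pos h1]
    refine ⟨?_, ?_⟩
    · simp only [hn]
      exact ⟨by positivity, (lt_div_iff₀ hc').1 h2⟩
    · simp only
      rw [mul_div_assoc, div_self hc, mul_one, Complex.exp_mul_I,
        Complex.arg_mul_cos_add_sin_mul_I h1]
      · exact abs_lt.2 ⟨h3, h4⟩
      · constructor <;> linarith [Real.pi_gt_three]

theorem raySector_isPreconnected {c : ℂ} (hc : c ≠ 0) {ε : ℝ} (hε : ε ≤ 1) :
    IsPreconnected (raySector c ε) := by
  rw [raySector_eq hc hε]
  exact ((convex_Ioo _ _).prod (convex_Ioo _ _)).isPreconnected.image _ (by fun_prop)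

theorem raySector_isOpen {c : ℂ} (hc : c ≠ 0) {ε : ℝ} (hε : ε ≤ 1) : IsOpen (raySector c ε) := by
  rw [isOpen_iff_mem_nhds]
  rintro z ⟨⟨h1, h2⟩, h3⟩
  have hz : z / c ≠ 0 := div_ne_zero (norm_pos_iff.1 h1) hc
  have hs : z / c ∈ Complex.slitPlane := by
    rw [Complex.mem_slitPlane_iff_arg]
    refine ⟨fun h => ?_, hz⟩
    rw [h, abs_of_pos Real.pi_pos] at h3
    linarith [Real.pi_gt_three]
  have h4 : ContinuousAt (fun z => Complex.arg (z / c)) z :=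
    ContinuousAt.comp (f := fun z => z / c) (Complex.continuousAt_arg hs) (by fun_prop)
  filter_upwards [continuous_norm.continuousAt.eventually (lt_mem_nhds h1),
    continuous_norm.continuousAt.eventually (gt_mem_nhds h2),
    h4.abs.eventually (gt_mem_nhds h3)] with y h h' h''
  exact ⟨⟨h, h'⟩, h''⟩

theorem rayFilter_neBot {c : ℂ} (hc : c ≠ 0) : (rayFilter c).NeBot := by
  rw [(rayFilter_hasBasis c).neBot_iff]
  intro ε hε
  have hc' : 0 < ‖c‖ := norm_pos_iff.2 hc
  refine ⟨((ε / 2 / ‖c‖ : ℝ) : ℂ) * c, ?_, ?_⟩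
  · have : ‖((ε / 2 / ‖c‖ : ℝ) : ℂ) * c‖ = ε / 2 := by
      rw [norm_mul, Complex.norm_real, Real.norm_of_nonneg (by positivity)]
      field_simp
    rw [this]
    constructor <;> linarith
  · rw [mul_div_assoc, div_self hc, mul_one, Complex.arg_ofReal_of_nonneg (by positivity)]
    simpa

/-- Multiplying by a function tending to `1` does not change the asymptotic direction. -/
theorem tendsto_rayFilter {c : ℂ} (hc : c ≠ 0) {f : ℂ → ℂ}
    (hf : Tendsto (fun z => f z / z) (𝓝[≠] 0) (𝓝 1)) : Tendsto f (rayFilter c) (rayFilter c) := by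
  have hf' := hf.mono_left (rayFilter_le c)
  have hz : ∀ᶠ z in rayFilter c, z ≠ 0 := rayFilter_le c self_mem_nhdsWithin
  have h : Tendsto (fun z : ℂ => (‖z‖, Complex.arg (z / c))) (rayFilter c) (𝓝[>] 0 ×ˢ 𝓝 0) :=
    tendsto_comap
  have h1 : Tendsto (fun z : ℂ => ‖z‖) (rayFilter c) (𝓝 0) :=
    (tendsto_fst.comp h).mono_right nhdsWithin_le_nhds
  have h2 : Tendsto (fun z : ℂ => Complex.arg (z / c)) (rayFilter c) (𝓝 0) := tendsto_snd.comp h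
  have h3 : Tendsto (fun z => Complex.arg (f z / z)) (rayFilter c) (𝓝 0) := by
    have := (Complex.continuousAt_arg (x := 1) (by simp)).tendsto.comp hf'
    rwa [Complex.arg_one] at this
  have h4 : ∀ᶠ z in rayFilter c, f z / z ≠ 0 := hf'.eventually_ne one_ne_zero
  refine tendsto_comap_iff.2 (Tendsto.prodMk (tendsto_nhdsWithin_iff.2 ⟨?_, ?_⟩) ?_)
  · have := h1.mul hf'.norm
    simp only [norm_one, mul_one] at this
    refine this.congr' ?_
    filter_upwards [hz] with z hz
    rw [← norm_mul, mul_div_cancel₀ _ hz]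
  · filter_upwards [h4] with z hz
    exact norm_pos_iff.2 (div_ne_zero_iff.1 hz).1
  · have := h2.add h3
    rw [add_zero] at this
    refine this.congr' ?_
    have h5 := this.eventually (Ioo_mem_nhds (neg_lt_zero.2 Real.pi_pos) Real.pi_pos)
    filter_upwards [hz, h4, h5] with z hz h4 h5
    rw [← Complex.arg_mul (div_ne_zero hz hc) h4 (Ioo_subset_Ioc_self h5)]
    congr 1
    field_simp

theorem tendsto_div_self {f : ℂ → ℂ} (hf : AnalyticAt ℂ f 0) (h0 : f 0 = 0) (h1 : deriv f 0 = 1) :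
    Tendsto (fun z => f z / z) (𝓝[≠] 0) (𝓝 1) := by
  have := hasDerivAt_iff_tendsto_slope.1 hf.differentiableAt.hasDerivAt
  rw [h1] at this
  refine this.congr fun z => ?_
  rw [slope_def_field, h0, sub_zero, sub_zero]

/-! ### Flat coordinates of an affine connection -/

/-- `W` is a flat coordinate of the affine connection `d + η dz` along the ray through `c`. -/
def IsFlatCoordinate (η : ℂ → ℂ) (c : ℂ) (W : ℂ → ℂ) : Prop :=
  ∀ᶠ z in rayFilter c, AnalyticAt ℂ W z ∧ deriv W z ≠ 0 ∧ deriv (deriv W) z = η z * deriv W z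

/-- Integrating twice, `W' = exp (∫ η)`. Primitives may be multivalued around the puncture, so they
are taken on a disc centred on the ray whose boundary passes through `0`; it contains a sector
around the ray. -/
theorem exists_isFlatCoordinate {η : ℂ → ℂ} (hη : ∀ᶠ z in 𝓝[≠] (0 : ℂ), AnalyticAt ℂ η z) {c : ℂ}
    (hc : c ≠ 0) : ∃ W, IsFlatCoordinate η c W := by
  rw [eventually_nhdsWithin_iff, Metric.eventually_nhds_iff] at hη
  obtain ⟨r, hr, hη⟩ := hη
  have hc' : 0 < ‖c‖ := norm_pos_iff.2 hc
  set ρ : ℝ := r / 2 / ‖c‖ with hρ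
  have hρ' : 0 < ρ := by positivity
  set B := Metric.ball ((ρ : ℂ) * c) (ρ * ‖c‖) with hB
  have hηB : ∀ z ∈ B, AnalyticAt ℂ η z := by
    intro z hz
    have hn : ‖(ρ : ℂ) * c‖ = ρ * ‖c‖ := by
      rw [norm_mul, Complex.norm_real, Real.norm_of_nonneg hρ'.le]
    refine hη ?_ ?_
    · rw [dist_zero_right]
      have h1 : ‖z - (ρ : ℂ) * c‖ < ρ * ‖c‖ := mem_ball_iff_norm.1 hz
      have h2 : ‖z‖ ≤ ‖z - (ρ : ℂ) * c‖ + ‖(ρ : ℂ) * c‖ := norm_le_norm_sub_add _ _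
      have h3 : ρ * ‖c‖ = r / 2 := by
        rw [hρ]
        field_simp
      linarith
    · rintro rfl
      have h1 : ‖0 - (ρ : ℂ) * c‖ < ρ * ‖c‖ := mem_ball_iff_norm.1 hz
      rw [zero_sub, norm_neg, hn] at h1
      exact lt_irrefl _ h1
  obtain ⟨E, hE⟩ := DifferentiableOn.isExactOn_ball (f := η) (c := (ρ : ℂ) * c) (r := ρ * ‖c‖)
    fun z hz => (hηB z hz).differentiableAt.differentiableWithinAt
  obtain ⟨W, hW⟩ := DifferentiableOn.isExactOn_ball (f := fun z => Complex.exp (E z))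
    (c := (ρ : ℂ) * c) (r := ρ * ‖c‖)
    fun z hz => (hE z hz).cexp.differentiableAt.differentiableWithinAt
  have hWB : ∀ z ∈ B, AnalyticAt ℂ W z ∧ deriv W z ≠ 0 ∧ deriv (deriv W) z = η z * deriv W z := by
    intro z hz
    have hBz : B ∈ 𝓝 z := Metric.isOpen_ball.mem_nhds hz
    have h1 : deriv W =ᶠ[𝓝 z] fun z => Complex.exp (E z) := by
      filter_upwards [hBz] with y hy using (hW y hy).deriv
    refine ⟨?_, ?_, ?_⟩
    · exact DifferentiableOn.analyticAt (s := B)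
        (fun y hy => (hW y hy).differentiableAt.differentiableWithinAt) hBz
    · rw [h1.self_of_nhds]
      exact Complex.exp_ne_zero _
    · rw [h1.deriv_eq, (hE z hz).cexp.deriv, h1.self_of_nhds, mul_comm]
  refine ⟨W, ?_⟩
  -- A half-opening of `1` suffices: `cos 1 ≥ 1/2` gives `Re x > ‖x‖ / 2`, and together with `‖x‖ <
  -- ρ` this forces `‖x - ρ‖ < ρ`.
  filter_upwards [raySector_mem (c := c) (ε := min 1 (ρ * ‖c‖)) (by positivity)] with z hz
  apply hWB
  obtain ⟨⟨h1, h2⟩, h3⟩ := hz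
  have h2' := h2.trans_le (min_le_right _ _)
  have h3' := h3.trans_le (min_le_left _ _)
  set x := z / c with hx
  have hzx : z = x * c := by rw [hx]; field_simp
  have hxpos : 0 < ‖x‖ := by
    rw [hx, norm_div]
    positivity
  have hxρ : ‖x‖ < ρ := by
    rw [hzx, norm_mul] at h2'
    exact lt_of_mul_lt_mul_right h2' hc'.le
  have hcos : 1 / 2 < Real.cos (Complex.arg x) := by
    have h4 := Real.cos_one_le
    have h5 : Real.cos 1 < Real.cos |Complex.arg x| :=
      Real.cos_lt_cos_of_nonneg_of_le_pi (abs_nonneg _) (by linarith [Real.pi_gt_three]) h3'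
    rw [Real.cos_abs] at h5
    have := Real.cos_one_pos
    have h6 : (1:ℝ) / 2 ≤ Real.cos 1 := by
      have := Real.one_sub_sq_div_two_le_cos (x := 1)
      norm_num at this ⊢
      linarith
    linarith
  have hre : ‖x‖ * (1 / 2) < x.re := by
    rw [← Complex.norm_mul_cos_arg x]
    exact mul_lt_mul_of_pos_left hcos hxpos
  rw [hB, mem_ball_iff_norm, hzx, ← sub_mul, norm_mul]
  refine mul_lt_mul_of_pos_right ?_ hc'
  refine lt_of_pow_lt_pow_left₀ 2 hρ'.le ?_
  have h7 : ‖x - ρ‖ ^ 2 = ‖x‖ ^ 2 - 2 * ρ * x.re + ρ ^ 2 := by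
    rw [Complex.sq_norm, Complex.sq_norm, Complex.normSq_apply, Complex.normSq_apply]
    simp
    ring
  rw [h7]
  nlinarith

/-- A germ tangent to the identity which preserves the connection acts on a flat coordinate by an
affine map. -/
theorem IsFlatCoordinate.exists_affine {η W f : ℂ → ℂ} {c : ℂ} (hc : c ≠ 0)
    (hW : IsFlatCoordinate η c W) (hf : AnalyticAt ℂ f 0) (h0 : f 0 = 0) (h1 : deriv f 0 = 1)
    (hp : PreservesConnection η f) :
    ∃ a b : ℂ, a ≠ 0 ∧ ∀ᶠ z in rayFilter c, W (f z) = a * W z + b := by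
  have ht := tendsto_rayFilter hc (tendsto_div_self hf h0 h1)
  have hle : rayFilter c ≤ 𝓝 0 := (rayFilter_le c).trans nhdsWithin_le_nhds
  have hall : ∀ᶠ z in rayFilter c,
      (AnalyticAt ℂ W z ∧ deriv W z ≠ 0 ∧ deriv (deriv W) z = η z * deriv W z) ∧
      (AnalyticAt ℂ W (f z) ∧ deriv W (f z) ≠ 0 ∧
        deriv (deriv W) (f z) = η (f z) * deriv W (f z)) ∧
      AnalyticAt ℂ f z ∧ deriv f z ≠ 0 ∧
        η (f z) * deriv f z ^ 2 + deriv (deriv f) z = η z * deriv f z := by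
    filter_upwards [hW, ht.eventually hW, hle hf.eventually_analyticAt,
      hle (hf.deriv.continuousAt.eventually_ne (by rw [h1]; exact one_ne_zero)),
      rayFilter_le c hp] with z a1 a2 a3 a4 a5
    exact ⟨a1, a2, a3, a4, a5⟩
  obtain ⟨ε, hε, hS⟩ := (rayFilter_hasBasis c).eventually_iff.1 hall
  set δ := min 1 ε
  have hδ : 0 < δ := by positivity
  have hsub : raySector c δ ⊆ raySector c ε := fun z hz =>
    ⟨⟨hz.1.1, hz.1.2.trans_le (min_le_right _ _)⟩, hz.2.trans_le (min_le_right _ _)⟩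
  have hopen : IsOpen (raySector c δ) := raySector_isOpen hc (min_le_left _ _)
  have hconn : IsPreconnected (raySector c δ) := raySector_isPreconnected hc (min_le_left _ _)
  have hX : ∀ z ∈ raySector c δ, HasDerivAt (fun z => W (f z)) (deriv W (f z) * deriv f z) z := by
    intro z hz
    obtain ⟨-, a2, a3, -, -⟩ := hS (hsub hz)
    exact a2.1.differentiableAt.hasDerivAt.comp z a3.differentiableAt.hasDerivAt
  -- Both `W ∘ f` and `W` are flat coordinates of the preserved connection, so the quotient of their
  -- derivatives is constant.
  have hq : ∀ z ∈ raySector c δ,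
      HasDerivAt (fun z => deriv W (f z) * deriv f z / deriv W z) 0 z := by
    intro z hz
    obtain ⟨a1, a2, a3, a4, a5⟩ := hS (hsub hz)
    have h := ((a2.1.deriv.differentiableAt.hasDerivAt.comp z
      a3.differentiableAt.hasDerivAt).mul a3.deriv.differentiableAt.hasDerivAt).div
      a1.1.deriv.differentiableAt.hasDerivAt a1.2.1
    refine h.congr_deriv ?_
    rw [a1.2.2, a2.2.2]
    simp only [Function.comp_apply, Pi.mul_apply]
    field_simp
    linear_combination (deriv W (f z) * (deriv W z)⁻¹) * a5
  obtain ⟨z₀, hz₀⟩ : (raySector c δ).Nonempty :=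
    (rayFilter_neBot hc).nonempty_of_mem (raySector_mem hδ)
  set a := deriv W (f z₀) * deriv f z₀ / deriv W z₀ with ha
  have hq' : ∀ z ∈ raySector c δ, deriv W (f z) * deriv f z = a * deriv W z := by
    intro z hz
    have := hopen.is_const_of_deriv_eq_zero hconn
      (fun y hy => (hq y hy).differentiableAt.differentiableWithinAt)
      (fun y hy => (hq y hy).deriv) hz hz₀
    rw [← ha, div_eq_iff (hS (hsub hz)).1.2.1] at this
    exact this
  have hd : ∀ z ∈ raySector c δ, HasDerivAt (fun z => W (f z) - a * W z) 0 z := by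
    intro z hz
    have h := (hX z hz).sub ((hS (hsub hz)).1.1.differentiableAt.hasDerivAt.const_mul a)
    rwa [hq' z hz, sub_self] at h
  refine ⟨a, W (f z₀) - a * W z₀, ?_, ?_⟩
  · obtain ⟨a1, a2, a3, a4, a5⟩ := hS (hsub hz₀)
    exact div_ne_zero (mul_ne_zero a2.2.1 a4) a1.2.1
  · filter_upwards [raySector_mem hδ] with z hz
    have := hopen.is_const_of_deriv_eq_zero hconn
      (fun y hy => (hd y hy).differentiableAt.differentiableWithinAt)
      (fun y hy => (hd y hy).deriv) hz hz₀
    linear_combination this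

/-- A flat coordinate is locally injective. -/
theorem IsFlatCoordinate.eventually_ne {η W : ℂ → ℂ} {c : ℂ} (hW : IsFlatCoordinate η c W) :
    ∀ᶠ z in rayFilter c, ∀ᶠ y in 𝓝[≠] z, W y ≠ W z := by
  filter_upwards [hW] with z hz
  exact hz.1.differentiableAt.hasDerivAt.eventually_ne hz.2.1

/-! ### Dynamics along an attracting direction -/

/-- `f` is tangent to the identity to order `k` at `0`, with attracting direction `c`, where `c` is
normalized by `f z = z - c (z / c) ^ (k + 1) + ⋯`. -/
def IsAttractingDirection (k : ℕ) (c : ℂ) (f : ℂ → ℂ) : Prop :=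
  ∃ u : ℂ → ℂ, AnalyticAt ℂ u 0 ∧ u 0 * c ^ k = -1 ∧ ∀ᶠ z in 𝓝 0, f z = z + z ^ (k + 1) * u z

theorem pow_re_im_eq (x : ℂ) (k : ℕ) :
    (x ^ k).re = ‖x‖ ^ k * Real.cos (k * Complex.arg x) ∧
      (x ^ k).im = ‖x‖ ^ k * Real.sin (k * Complex.arg x) := by
  have h : x ^ k = ((‖x‖ ^ k : ℝ) : ℂ) * Complex.exp (((k * Complex.arg x : ℝ) : ℂ) * Complex.I) := by
    conv_lhs => rw [← Complex.norm_mul_exp_arg_mul_I x]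
    rw [mul_pow, ← Complex.exp_nat_mul]
    push_cast
    ring_nf
  rw [h, Complex.re_ofReal_mul, Complex.im_ofReal_mul, Complex.exp_ofReal_mul_I_re,
    Complex.exp_ofReal_mul_I_im]
  exact ⟨rfl, rfl⟩

theorem half_norm_le_re_pow {x : ℂ} {k : ℕ} (hx : k * |Complex.arg x| ≤ 1) :
    ‖x ^ k‖ / 2 ≤ (x ^ k).re := by
  rw [(pow_re_im_eq x k).1, norm_pow]
  have h1 : |(k : ℝ) * Complex.arg x| ≤ 1 := by rwa [abs_mul, Nat.abs_cast]
  have h2 := Real.one_sub_sq_div_two_le_cos (x := (k : ℝ) * Complex.arg x)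
  have h3 : ((k : ℝ) * Complex.arg x) ^ 2 ≤ 1 := (sq_le_one_iff_abs_le_one _).2 h1
  have h4 : 0 ≤ ‖x‖ ^ k := by positivity
  nlinarith

namespace IsAttractingDirection

variable {k : ℕ} {c : ℂ} {f : ℂ → ℂ}

/-- The normalization `u 0 * c ^ k = -1` turns the leading term into `-(z / c) ^ k`. With `τ = (z /
c) ^ k`, all estimates below are expansions in `τ`, whose real part is positive near the ray. -/
theorem exists_ratio (hf : IsAttractingDirection k c f) (hc : c ≠ 0) :
    ∃ e : ℂ → ℂ, Tendsto e (𝓝[≠] 0) (𝓝 1) ∧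
      ∀ᶠ z in 𝓝[≠] 0, f z = z * (1 - (z / c) ^ k * e z) := by
  obtain ⟨u, hu, hu0, hfu⟩ := hf
  have hne : u 0 ≠ 0 := fun h => by simp [h] at hu0
  refine ⟨fun z => u z / u 0, ?_, ?_⟩
  · have := (hu.continuousAt.tendsto.div_const (u 0)).mono_left
      (nhdsWithin_le_nhds (s := {0}ᶜ))
    rwa [div_self hne] at this
  · filter_upwards [nhdsWithin_le_nhds hfu] with z hz
    have h1 : u 0 = -1 / c ^ k := by
      rw [eq_div_iff (pow_ne_zero k hc), hu0]
    rw [hz, h1, div_pow]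
    field_simp
    ring

theorem tendsto_pow (hk : 1 ≤ k) (c : ℂ) : Tendsto (fun z : ℂ => (z / c) ^ k) (𝓝[≠] 0) (𝓝 0) := by
  have : Tendsto (fun z : ℂ => (z / c) ^ k) (𝓝 0) (𝓝 ((0 / c) ^ k)) :=
    (by fun_prop : Continuous fun z : ℂ => (z / c) ^ k).tendsto 0
  rw [zero_div, zero_pow (by omega)] at this
  exact this.mono_left nhdsWithin_le_nhds

theorem tendsto_div (hf : IsAttractingDirection k c f) (hk : 1 ≤ k) (hc : c ≠ 0) :
    Tendsto (fun z => f z / z) (𝓝[≠] 0) (𝓝 1) := by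
  obtain ⟨e, he, hfe⟩ := hf.exists_ratio hc
  have := ((tendsto_pow hk c).mul he).const_sub 1
  rw [zero_mul, sub_zero] at this
  refine this.congr' ?_
  filter_upwards [hfe, self_mem_nhdsWithin] with z hz (hz0 : z ≠ 0)
  rw [hz, mul_div_cancel_left₀ _ hz0]

/-- Narrow sectors around an attracting direction are invariant. -/
theorem eventually_arg_le (hf : IsAttractingDirection k c f) (hk : 1 ≤ k) (hc : c ≠ 0) {θ : ℝ}
    (hθ : 0 < θ) (hkθ : k * θ ≤ 1) :
    ∀ᶠ z in 𝓝[≠] 0, |Complex.arg (z / c)| ≤ θ → |Complex.arg (f z / c)| ≤ θ := by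
  obtain ⟨e, he, hfe⟩ := hf.exists_ratio hc
  have hk' : (1 : ℝ) ≤ k := by exact_mod_cast hk
  have hπ := Real.pi_gt_three
  have hθ1 : θ ≤ 1 := by nlinarith
  have hQ := hf.tendsto_div hk hc
  have harg : Tendsto (fun z => Complex.arg (f z / z)) (𝓝[≠] 0) (𝓝 0) := by
    have := (Complex.continuousAt_arg (x := 1) (by simp)).tendsto.comp hQ
    rwa [Complex.arg_one] at this
  have hσ : 0 < Real.sin (k * (θ / 2)) :=
    Real.sin_pos_of_pos_of_lt_pi (by positivity) (by nlinarith)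
  have he' : ∀ᶠ z in 𝓝[≠] (0 : ℂ), ‖e z - 1‖ < Real.sin (k * (θ / 2)) := by
    have := he.eventually (Metric.ball_mem_nhds 1 hσ)
    simpa only [Metric.mem_ball, dist_eq_norm] using this
  filter_upwards [hfe, he', hQ.eventually_ne one_ne_zero,
    harg.eventually (Icc_mem_nhds (neg_lt_zero.2 (half_pos hθ)) (half_pos hθ)),
    self_mem_nhdsWithin] with z hz hez hQz hargz (hz0 : z ≠ 0) hza
  have hx0 : z / c ≠ 0 := div_ne_zero hz0 hc
  have hfz : f z / c = (z / c) * (f z / z) := by field_simp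
  rw [abs_le] at hza
  have hsum : Complex.arg (f z / c) = Complex.arg (z / c) + Complex.arg (f z / z) := by
    rw [hfz, Complex.arg_mul hx0 hQz]
    constructor <;> linarith [hargz.1, hargz.2]
  have him : (f z / z).im = -((z / c) ^ k).im - ((z / c) ^ k * (e z - 1)).im := by
    rw [hz, mul_div_cancel_left₀ _ hz0]
    simp only [Complex.sub_im, Complex.one_im, Complex.mul_im, Complex.sub_re, Complex.one_re]
    ring
  have hτ : 0 < ‖z / c‖ ^ k := by positivity
  have hsmall : |((z / c) ^ k * (e z - 1)).im| < ‖z / c‖ ^ k * Real.sin (k * (θ / 2)) := by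
    refine (Complex.abs_im_le_norm _).trans_lt ?_
    rw [norm_mul, norm_pow]
    exact mul_lt_mul_of_pos_left hez hτ
  rw [abs_lt] at hsmall
  have hmono : ∀ t : ℝ, θ / 2 ≤ t → t ≤ θ → Real.sin (k * (θ / 2)) ≤ Real.sin (k * t) := by
    intro t h1 h2
    apply Real.sin_le_sin_of_le_of_le_pi_div_two
    · nlinarith
    · nlinarith
    · exact mul_le_mul_of_nonneg_left h1 (by linarith)
  rw [hsum, abs_le]
  -- In the outer half of the sector the imaginary part of `-τ` dominates the error and turns the
  -- argument back towards `0`; in the inner half a rotation by at most `θ / 2` cannot leave the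
  -- sector.
  rcases le_or_gt (θ / 2) (Complex.arg (z / c)) with h | h
  · have : Complex.arg (f z / z) < 0 := by
      rw [Complex.arg_neg_iff, him, (pow_re_im_eq _ _).2]
      have := mul_le_mul_of_nonneg_left (hmono _ h hza.2) hτ.le
      linarith [hsmall.1]
    constructor <;> linarith [hargz.1]
  · rcases le_or_gt (Complex.arg (z / c)) (-(θ / 2)) with h' | h'
    · have : 0 ≤ Complex.arg (f z / z) := by
        rw [Complex.arg_nonneg_iff, him, (pow_re_im_eq _ _).2]
        have := mul_le_mul_of_nonneg_left (hmono (-Complex.arg (z / c)) (by linarith)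
          (by linarith)) hτ.le
        rw [mul_neg, Real.sin_neg] at this
        linarith [hsmall.2]
      constructor <;> linarith [hargz.2]
    · constructor <;> linarith [hargz.1, hargz.2]

/-- Expand `‖1 - τ e‖ ^ 2` and use `1 + x ≤ exp x`; the quadratic term and the error `e - 1` are
absorbed by `κ ‖τ‖`. -/
theorem eventually_norm_le (hf : IsAttractingDirection k c f) (hk : 1 ≤ k) (hc : c ≠ 0) {κ : ℝ}
    (hκ : 0 < κ) :
    ∀ᶠ z in 𝓝[≠] 0, ‖f z‖ ≤ ‖z‖ * Real.exp (-((z / c) ^ k).re + κ * ‖(z / c) ^ k‖) := by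
  obtain ⟨e, he, hfe⟩ := hf.exists_ratio hc
  have he1 : ∀ᶠ z in 𝓝[≠] (0 : ℂ), ‖e z - 1‖ < min 1 (κ / 2) := by
    have := he.eventually (Metric.ball_mem_nhds 1 (show 0 < min 1 (κ / 2) by positivity))
    simpa only [Metric.mem_ball, dist_eq_norm] using this
  have hτ : ∀ᶠ z in 𝓝[≠] (0 : ℂ), ‖(z / c) ^ k‖ < κ / 4 := by
    have := (tendsto_pow hk c).eventually (Metric.ball_mem_nhds 0 (show 0 < κ / 4 by positivity))
    simpa only [Metric.mem_ball, dist_zero_right] using this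
  filter_upwards [hfe, he1, hτ] with z hz hez hτz
  set τ := (z / c) ^ k
  rw [hz, norm_mul]
  refine mul_le_mul_of_nonneg_left ?_ (norm_nonneg z)
  refine (pow_le_pow_iff_left₀ (norm_nonneg _) (Real.exp_pos _).le two_ne_zero).1 ?_
  have h1 : ‖1 - τ * e z‖ ^ 2 = 1 + (-2 * (τ * e z).re + ‖τ * e z‖ ^ 2) := by
    rw [Complex.sq_norm, Complex.sq_norm, Complex.normSq_apply, Complex.normSq_apply]
    simp only [Complex.sub_re, Complex.sub_im, Complex.one_re, Complex.one_im]
    ring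
  have h2 : ‖e z‖ ≤ 2 := by
    have := norm_le_norm_sub_add (e z) 1
    rw [norm_one] at this
    linarith [hez.trans_le (min_le_left 1 (κ / 2))]
  have h3 : τ.re - ‖τ‖ * (κ / 2) ≤ (τ * e z).re := by
    have h4 : (τ * e z).re = τ.re + (τ * (e z - 1)).re := by
      rw [← Complex.add_re]
      ring_nf
    have h5 := Complex.abs_re_le_norm (τ * (e z - 1))
    rw [norm_mul] at h5
    have h6 : ‖τ‖ * ‖e z - 1‖ ≤ ‖τ‖ * (κ / 2) :=
      mul_le_mul_of_nonneg_left (hez.le.trans (min_le_right _ _)) (norm_nonneg _)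
    have h7 := (abs_le.1 h5).1
    linarith
  have h4 : ‖τ * e z‖ ^ 2 ≤ κ * ‖τ‖ := by
    rw [norm_mul]
    have h5 : ‖τ‖ * ‖e z‖ ≤ ‖τ‖ * 2 := mul_le_mul_of_nonneg_left h2 (norm_nonneg _)
    have h6 : (‖τ‖ * ‖e z‖) ^ 2 ≤ (‖τ‖ * 2) ^ 2 := pow_le_pow_left₀ (by positivity) h5 2
    nlinarith [norm_nonneg τ]
  rw [h1, add_comm 1, ← Real.exp_nat_mul]
  refine (Real.add_one_le_exp _).trans (Real.exp_le_exp.2 ?_)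
  push_cast
  linarith

/-- Nearby points approach each other at most at the rate given by the derivative. -/
theorem exists_le_norm_sub (hf : IsAttractingDirection k c f) (hc : c ≠ 0) {κ : ℝ} (hκ : 0 < κ) :
    ∃ ε > 0, ∀ z, z ≠ 0 → ‖z‖ < ε → ∀ y, ‖y - z‖ ≤ ε * ‖z‖ →
      ‖y - z‖ * (1 - (k + 1) * ((z / c) ^ k).re - κ * ‖(z / c) ^ k‖) ≤ ‖f y - f z‖ := by
  obtain ⟨u, hu, hu0, hfu⟩ := hf
  have hck : 0 < ‖c‖ ^ k := by positivity
  -- The derivative of `ξ ^ (k + 1) * u ξ` is `z ^ k` times this function at `(ξ / z, ξ)`.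
  -- Continuity at `(1, 0)` therefore compares it with `(k + 1) * u 0 * z ^ k` on a whole ball of
  -- radius `ε * ‖z‖`.
  have hΦ : ContinuousAt (fun x : ℂ × ℂ =>
      x.1 ^ k * ((k + 1) * u x.2 + x.2 * deriv u x.2)) (1, 0) := by
    have h1 : ContinuousAt (fun x : ℂ × ℂ => u x.2) (1, 0) :=
      ContinuousAt.comp (g := u) (f := Prod.snd) hu.continuousAt continuousAt_snd
    have h2 : ContinuousAt (fun x : ℂ × ℂ => deriv u x.2) (1, 0) :=
      ContinuousAt.comp (g := deriv u) (f := Prod.snd) hu.deriv.continuousAt continuousAt_snd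
    exact (continuousAt_fst.pow k).mul
      ((continuousAt_const.mul h1).add (continuousAt_snd.mul h2))
  have hΦ' := hΦ.eventually (Metric.ball_mem_nhds _ (show 0 < κ / ‖c‖ ^ k by positivity))
  rw [Metric.eventually_nhds_iff] at hΦ'
  obtain ⟨δ, hδ, hΦδ⟩ := hΦ'
  obtain ⟨r, hr, hur⟩ := Metric.eventually_nhds_iff.1 (hu.eventually_analyticAt.and hfu)
  simp only [dist_zero_right] at hur
  set ε := min (δ / 2) (min (r / 2) 1) / 2 with hε
  have hε0 : 0 < ε := by positivity
  have hε1 : 2 * ε ≤ 1 := by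
    have : min (δ / 2) (min (r / 2) 1) ≤ 1 := (min_le_right _ _).trans (min_le_right _ _)
    linarith
  have hεδ : 2 * ε ≤ δ / 2 := by
    have : min (δ / 2) (min (r / 2) 1) ≤ δ / 2 := min_le_left _ _
    linarith
  have hεr : 2 * ε ≤ r / 2 := by
    have : min (δ / 2) (min (r / 2) 1) ≤ r / 2 := (min_le_right _ _).trans (min_le_left _ _)
    linarith
  refine ⟨ε, hε0, fun z hz hzε y hy => ?_⟩
  have hzpos : 0 < ‖z‖ := norm_pos_iff.2 hz
  set τ := (z / c) ^ k with hτ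
  have hball : ∀ ξ ∈ Metric.closedBall z (ε * ‖z‖), ‖ξ‖ < 2 * ε ∧ ‖ξ / z - 1‖ ≤ ε := by
    intro ξ hξ
    rw [mem_closedBall_iff_norm] at hξ
    constructor
    · have := norm_le_norm_sub_add ξ z
      nlinarith
    · rw [show ξ / z - 1 = (ξ - z) / z by field_simp, norm_div, div_le_iff₀ hzpos]
      exact hξ
  have hderiv : ∀ ξ ∈ Metric.closedBall z (ε * ‖z‖),
      HasDerivAt (fun ξ => ξ ^ (k + 1) * u ξ - (k + 1) * u 0 * z ^ k * ξ)
        (((k + 1 : ℕ) : ℂ) * ξ ^ k * 1 * u ξ + ξ ^ (k + 1) * deriv u ξ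
          - (k + 1) * u 0 * z ^ k * 1) ξ := by
    intro ξ hξ
    have h1 := (hur (show ‖ξ‖ < r by linarith [(hball ξ hξ).1])).1
    have h2 := (((hasDerivAt_id ξ).pow (k + 1)).mul h1.differentiableAt.hasDerivAt).sub
      ((hasDerivAt_id ξ).const_mul ((k + 1) * u 0 * z ^ k))
    exact h2
  have hbound : ∀ ξ ∈ Metric.closedBall z (ε * ‖z‖),
      ‖deriv (fun ξ => ξ ^ (k + 1) * u ξ - (k + 1) * u 0 * z ^ k * ξ) ξ‖ ≤ κ * ‖τ‖ := by
    intro ξ hξ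
    rw [(hderiv ξ hξ).deriv]
    have h1 : dist ((ξ / z, ξ) : ℂ × ℂ) (1, 0) < δ := by
      rw [Prod.dist_eq, max_lt_iff]
      simp only [dist_eq_norm, sub_zero]
      constructor <;> linarith [(hball ξ hξ).1, (hball ξ hξ).2]
    have h2 := hΦδ h1
    simp only [dist_eq_norm, one_pow, one_mul, zero_mul, add_zero] at h2
    have h3 : ((k + 1 : ℕ) : ℂ) * ξ ^ k * 1 * u ξ + ξ ^ (k + 1) * deriv u ξ
          - (k + 1) * u 0 * z ^ k * 1 = z ^ k *
        ((ξ / z) ^ k * ((k + 1) * u ξ + ξ * deriv u ξ) - (k + 1) * u 0) := by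
      rw [div_pow]
      field_simp
      push_cast
      ring
    have h4 : ‖τ‖ = ‖z‖ ^ k / ‖c‖ ^ k := by rw [hτ, norm_pow, norm_div, div_pow]
    rw [h3, norm_mul, norm_pow, h4]
    calc ‖z‖ ^ k * _ ≤ ‖z‖ ^ k * (κ / ‖c‖ ^ k) :=
          mul_le_mul_of_nonneg_left h2.le (by positivity)
      _ = κ * (‖z‖ ^ k / ‖c‖ ^ k) := by ring
  have hzB : z ∈ Metric.closedBall z (ε * ‖z‖) := Metric.mem_closedBall_self (by positivity)
  have hyB : y ∈ Metric.closedBall z (ε * ‖z‖) := mem_closedBall_iff_norm.2 hy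
  have hmv := Convex.norm_image_sub_le_of_norm_deriv_le
    (fun ξ hξ => (hderiv ξ hξ).differentiableAt) hbound (convex_closedBall _ _) hzB hyB
  have hfy := (hur (show ‖y‖ < r by linarith [(hball y hyB).1])).2
  have hfz := (hur (show ‖z‖ < r by linarith [(hball z hzB).1])).2
  have huc : u 0 * z ^ k = -τ := by
    have h1 : u 0 = -1 / c ^ k := by rw [eq_div_iff (pow_ne_zero k hc), hu0]
    rw [hτ, h1, div_pow]
    ring
  have hdecomp : (y - z) * (1 - (k + 1) * τ) = (f y - f z) -
      ((y ^ (k + 1) * u y - (k + 1) * u 0 * z ^ k * y) -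
        (z ^ (k + 1) * u z - (k + 1) * u 0 * z ^ k * z)) := by
    rw [hfy, hfz]
    linear_combination (-(k + 1) * (y - z)) * huc
  have h1 : ‖y - z‖ * ‖1 - (k + 1) * τ‖ ≤ ‖f y - f z‖ + κ * ‖τ‖ * ‖y - z‖ := by
    rw [← norm_mul, hdecomp]
    exact (norm_sub_le _ _).trans (by gcongr)
  have h2 : 1 - (k + 1) * τ.re ≤ ‖1 - ((k : ℂ) + 1) * τ‖ := by
    refine le_trans (le_of_eq ?_) (Complex.re_le_norm _)
    simp
  have h3 := mul_le_mul_of_nonneg_left h2 (norm_nonneg (y - z))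
  linarith

end IsAttractingDirection

namespace IsAttractingDirection

variable {k : ℕ} {c : ℂ} {f : ℂ → ℂ}

/-- In a sector around an attracting direction the map `f` is contracting, and the quantity
`‖y - z‖ ^ 2 / ‖z‖ ^ (2 * k + 3)` does not decrease under `f`. -/
theorem exists_contracting (hf : IsAttractingDirection k c f) (hk : 1 ≤ k) (hc : c ≠ 0) :
    ∃ ε > 0, ∀ z, z ≠ 0 → ‖z‖ < ε → k * |Complex.arg (z / c)| ≤ 1 →
      f z ≠ 0 ∧ ‖f z‖ ≤ ‖z‖ * Real.exp (-(‖z‖ / ‖c‖) ^ k / 4) ∧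
      ∀ y, ‖y - z‖ ≤ ε * ‖z‖ →
        ‖y - z‖ ^ 2 * ‖f z‖ ^ (2 * k + 3) ≤ ‖f y - f z‖ ^ 2 * ‖z‖ ^ (2 * k + 3) := by
  -- The exponent `2 * k + 3` exceeds by one the exponent `2 * (k + 1)` at which squared distances
  -- contract. This leaves a margin `Re τ ≥ ‖τ‖ / 2`, and the errors add up to `(2 * k + 7) * κ *
  -- ‖τ‖`, which this `κ` makes fit.
  set κ : ℝ := 1 / (16 * (k + 4)) with hκ
  have hκ0 : 0 < κ := by positivity
  have hκk : κ * (16 * (k + 4)) = 1 := by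
    rw [hκ]
    field_simp
  have hk0 : (0 : ℝ) ≤ k := Nat.cast_nonneg k
  obtain ⟨ε₁, hε₁, hsep⟩ := hf.exists_le_norm_sub hc hκ0
  have hτs : ∀ᶠ z in 𝓝[≠] (0 : ℂ), ‖(z / c) ^ k‖ < κ / (2 * (k + 2) ^ 2) := by
    have := (tendsto_pow hk c).eventually
      (Metric.ball_mem_nhds 0 (show 0 < κ / (2 * (k + 2) ^ 2) by positivity))
    simpa only [Metric.mem_ball, dist_zero_right] using this
  have hall := ((hf.tendsto_div hk hc).eventually_ne one_ne_zero).and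
    ((hf.eventually_norm_le hk hc hκ0).and hτs)
  rw [eventually_nhdsWithin_iff, Metric.eventually_nhds_iff] at hall
  obtain ⟨ε₂, hε₂, hall⟩ := hall
  simp only [dist_zero_right] at hall
  refine ⟨min ε₁ ε₂, by positivity, fun z hz hzε hza => ?_⟩
  obtain ⟨hfz, hn, hτ⟩ := hall (hzε.trans_le (min_le_right _ _)) hz
  have hre := half_norm_le_re_pow hza
  have hre' : ((z / c) ^ k).re ≤ ‖(z / c) ^ k‖ := Complex.re_le_norm _
  have hnorm : (‖z‖ / ‖c‖) ^ k = ‖(z / c) ^ k‖ := by rw [norm_pow, norm_div]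
  set X := ((z / c) ^ k).re
  set T := ‖(z / c) ^ k‖
  have hT0 : 0 ≤ T := norm_nonneg _
  have hκk0 : 0 ≤ κ * k := by positivity
  have hκ4 : κ ≤ 1 / 64 := by linarith
  refine ⟨(div_ne_zero_iff.1 hfz).1, ?_, fun y hy => ?_⟩
  · rw [hnorm]
    refine hn.trans (mul_le_mul_of_nonneg_left (Real.exp_le_exp.2 ?_) (norm_nonneg z))
    have := mul_le_mul_of_nonneg_right hκ4 hT0
    linarith
  · have hs := hsep z hz (hzε.trans_le (min_le_left _ _)) y
      (hy.trans (mul_le_mul_of_nonneg_right (min_le_left _ _) (norm_nonneg z)))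
    have hT1 : T * (2 * (k + 2) ^ 2) ≤ κ := ((lt_div_iff₀ (by positivity)).1 hτ).le
    set x := (k + 1) * X + κ * T with hx
    have hx0 : 0 ≤ x := by
      have : 0 ≤ X := by linarith
      positivity
    have hxT : x ≤ (k + 2) * T := by
      have h1 := mul_le_mul_of_nonneg_left hre' (show 0 ≤ (k : ℝ) + 1 by positivity)
      have h2 := mul_le_mul_of_nonneg_right hκ4 hT0
      linarith
    have hx2 : x ≤ 1 / 2 := by
      have h1 : 0 ≤ 2 * T * (k + 2) * k := by positivity
      linarith
    have hxsq : 2 * x ^ 2 ≤ κ * T := by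
      have : x ^ 2 ≤ ((k + 2) * T) ^ 2 := pow_le_pow_left₀ hx0 hxT 2
      have := mul_le_mul_of_nonneg_left hT1 hT0
      linarith
    -- For `0 ≤ x ≤ 1/2` one has `log (1 - x) ≥ -x - 2 * x ^ 2`; the second `κ * T` on the left pays
    -- for the quadratic term.
    have hexp : Real.exp (-((k + 1) * X) - 2 * κ * T) ≤ 1 - (k + 1) * X - κ * T := by
      have h1 : 0 < 1 - x := by linarith
      have h2 : -((k + 1) * X) - 2 * κ * T ≤ Real.log (1 - x) := by
        refine le_trans ?_ (Real.one_sub_inv_le_log_of_pos h1)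
        have h3 : 1 - (1 - x)⁻¹ = -(x + x ^ 2 / (1 - x)) := by
          field_simp
          ring
        have h4 : x ^ 2 / (1 - x) ≤ 2 * x ^ 2 := by
          rw [div_le_iff₀ h1]
          nlinarith [sq_nonneg x]
        rw [h3]
        linarith
      have h3 := Real.exp_le_exp.2 h2
      rw [Real.exp_log h1] at h3
      linarith
    have hs' : ‖y - z‖ * Real.exp (-((k + 1) * X) - 2 * κ * T) ≤ ‖f y - f z‖ :=
      (mul_le_mul_of_nonneg_left hexp (norm_nonneg _)).trans hs
    have hs2 : ‖y - z‖ ^ 2 * Real.exp (2 * (-((k + 1) * X) - 2 * κ * T)) ≤ ‖f y - f z‖ ^ 2 := by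
      have := pow_le_pow_left₀ (by positivity) hs' 2
      rwa [mul_pow, ← Real.exp_nat_mul, Nat.cast_ofNat] at this
    have hn2 : ‖f z‖ ^ (2 * k + 3) ≤
        ‖z‖ ^ (2 * k + 3) * Real.exp ((2 * k + 3) * (-X + κ * T)) := by
      have := pow_le_pow_left₀ (norm_nonneg _) hn (2 * k + 3)
      rw [mul_pow, ← Real.exp_nat_mul] at this
      exact_mod_cast this
    have hcmp : Real.exp ((2 * k + 3) * (-X + κ * T)) ≤
        Real.exp (2 * (-((k + 1) * X) - 2 * κ * T)) := by
      refine Real.exp_le_exp.2 ?_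
      have h1 : κ * (2 * k + 7) ≤ 1 / 2 := by linarith
      have h2 := mul_le_mul_of_nonneg_right h1 hT0
      linarith
    calc ‖y - z‖ ^ 2 * ‖f z‖ ^ (2 * k + 3)
        ≤ ‖y - z‖ ^ 2 * (‖z‖ ^ (2 * k + 3) * Real.exp (2 * (-((k + 1) * X) - 2 * κ * T))) := by
          gcongr
          exact hn2.trans (mul_le_mul_of_nonneg_left hcmp (by positivity))
      _ = ‖y - z‖ ^ 2 * Real.exp (2 * (-((k + 1) * X) - 2 * κ * T)) * ‖z‖ ^ (2 * k + 3) := by ring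
      _ ≤ _ := by gcongr

/-- Orbits that stay in a contracting sector converge to `0`. -/
theorem tendsto_zero_of_le {a : ℕ → ℝ} {d : ℝ} (hd : 0 < d) (ha : ∀ n, 0 < a n)
    (h : ∀ n, a (n + 1) ≤ a n * Real.exp (-(a n / d) ^ k / 4)) : Tendsto a atTop (𝓝 0) := by
  have hanti : Antitone a := by
    refine antitone_nat_of_succ_le fun n => (h n).trans ?_
    refine mul_le_of_le_one_right (ha n).le (Real.exp_le_one_iff.2 ?_)
    have : 0 ≤ (a n / d) ^ k := pow_nonneg (div_nonneg (ha n).le hd.le) k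
    linarith
  have hbdd : BddBelow (range a) := ⟨0, by rintro _ ⟨n, rfl⟩; exact (ha n).le⟩
  have hlim := tendsto_atTop_ciInf hanti hbdd
  set L := ⨅ n, a n
  have hL0 : 0 ≤ L := ge_of_tendsto' hlim fun n => (ha n).le
  -- Passing to the limit in the recursion excludes a positive limit.
  have hL : L ≤ L * Real.exp (-(L / d) ^ k / 4) := by
    have hcont : Continuous fun x : ℝ => x * Real.exp (-(x / d) ^ k / 4) := by fun_prop
    exact le_of_tendsto_of_tendsto' (hlim.comp (tendsto_add_atTop_nat 1))
      ((hcont.tendsto L).comp hlim) h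
  rcases hL0.eq_or_lt with h0 | h0
  · rwa [← h0] at hlim
  · exfalso
    have h1 : Real.exp (-(L / d) ^ k / 4) < 1 := by
      rw [Real.exp_lt_one_iff]
      have : 0 < (L / d) ^ k := by positivity
      linarith
    nlinarith

end IsAttractingDirection

/-- A property which holds eventually along a ray holds in balls of relative size `ε` around the
points of a sector. -/
theorem exists_forall_of_eventually_rayFilter {c : ℂ} (hc : c ≠ 0) {P : ℂ → Prop}
    (hP : ∀ᶠ z in rayFilter c, P z) :
    ∃ ε > 0, ∀ z, z ≠ 0 → ‖z‖ < ε → |Complex.arg (z / c)| ≤ ε →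
      ∀ y, ‖y - z‖ ≤ ε * ‖z‖ → P y := by
  obtain ⟨ε₀, hε₀, hS⟩ := (rayFilter_hasBasis c).eventually_iff.1 hP
  set ε₁ := min ε₀ 1
  have hε₁ : 0 < ε₁ := by positivity
  have hε₁1 : ε₁ ≤ 1 := min_le_right _ _
  have harg : ∀ᶠ t in 𝓝 (1 : ℂ), |Complex.arg t| < ε₁ / 2 := by
    have h := (Complex.continuousAt_arg (x := 1) (by simp)).abs.eventually
      (gt_mem_nhds (show |Complex.arg 1| < ε₁ / 2 by simp [hε₁]))
    exact h
  obtain ⟨δ, hδ, hδa⟩ := Metric.eventually_nhds_iff.1 harg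
  have hpos : 0 < min (δ / 2) (ε₁ / 2) := by positivity
  refine ⟨min (δ / 2) (ε₁ / 2), hpos, fun z hz hzε hza y hy => ?_⟩
  have e1 : min (δ / 2) (ε₁ / 2) ≤ δ / 2 := min_le_left _ _
  have e2 : min (δ / 2) (ε₁ / 2) ≤ ε₁ / 2 := min_le_right _ _
  set ε := min (δ / 2) (ε₁ / 2)
  have hzpos : 0 < ‖z‖ := norm_pos_iff.2 hz
  have h1 : ‖y / z - 1‖ ≤ ε := by
    rw [show y / z - 1 = (y - z) / z by field_simp, norm_div, div_le_iff₀ hzpos]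
    exact hy
  have h2 := hδa (y := y / z) (by rw [dist_eq_norm]; linarith)
  have hy0 : y ≠ 0 := by
    rintro rfl
    rw [zero_div, zero_sub, norm_neg, norm_one] at h1
    linarith
  apply hS
  have hε₁0 : ε₁ ≤ ε₀ := min_le_left _ _
  refine ⟨⟨norm_pos_iff.2 hy0, ?_⟩, ?_⟩
  · have := norm_le_norm_sub_add y z
    nlinarith
  · rw [show y / c = z / c * (y / z) by field_simp,
      Complex.arg_mul (div_ne_zero hz hc) (div_ne_zero hy0 hz)]
    · exact (abs_add_le _ _).trans_lt (by linarith)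
    · have h3 := abs_le.1 hza
      have h4 := abs_lt.1 h2
      constructor <;> linarith [Real.pi_gt_three]

/-- A locally injective function along an attracting direction of `f` cannot be invariant both under
`f` and under a map which is tangent to the identity to a higher order. -/
theorem IsAttractingDirection.false_of_invariant {k : ℕ} {c : ℂ} {f g h W : ℂ → ℂ} {C : ℝ}
    (hf : IsAttractingDirection k c f) (hk : 1 ≤ k) (hc : c ≠ 0)
    (hg : AnalyticAt ℂ g 0)
    (hgf : ∀ᶠ z in 𝓝 0, g (f z) = z) (hfg : ∀ᶠ z in 𝓝 0, f (g z) = z)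
    (hh : ∀ᶠ z in 𝓝 0, ‖h z - z‖ ≤ C * ‖z‖ ^ (k + 2)) (hne : ∀ᶠ z in 𝓝[≠] 0, h z ≠ z)
    (hWf : ∀ᶠ z in rayFilter c, W (f z) = W z) (hWg : ∀ᶠ z in rayFilter c, W (g z) = W z)
    (hWh : ∀ᶠ z in rayFilter c, W (h z) = W z)
    (hW : ∀ᶠ z in rayFilter c, ∀ᶠ y in 𝓝[≠] z, W y ≠ W z) : False := by
  have hk0 : (0 : ℝ) < k := by exact_mod_cast hk
  obtain ⟨ε₁, hε₁, hthick⟩ := exists_forall_of_eventually_rayFilter hc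
    (hWf.and (hWg.and (hWh.and hW)))
  obtain ⟨ε₂, hε₂, hcon⟩ := hf.exists_contracting hk hc
  obtain ⟨K, s, hs, hLip⟩ := hg.hasStrictDerivAt.hasStrictFDerivAt.exists_lipschitzOnWith
  have hloc : ∀ᶠ z in 𝓝 (0 : ℂ), z ∈ s ∧ g (f z) = z ∧ f (g z) = z ∧
      ‖h z - z‖ ≤ C * ‖z‖ ^ (k + 2) := by
    filter_upwards [hs, hgf, hfg, hh] with z h1 h2 h3 h4 using ⟨h1, h2, h3, h4⟩
  obtain ⟨r, hr, hloc⟩ := Metric.eventually_nhds_iff.1 hloc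
  simp only [dist_zero_right] at hloc
  -- the common sector
  set θ := min ε₁ (1 / k)
  have hθ : 0 < θ := by positivity
  have hkθ : k * θ ≤ 1 := by
    calc k * θ ≤ k * (1 / k) := by gcongr; exact min_le_right _ _
      _ = 1 := by field_simp
  have hpunct := (hf.eventually_arg_le hk hc hθ hkθ).and hne
  rw [eventually_nhdsWithin_iff, Metric.eventually_nhds_iff] at hpunct
  obtain ⟨r', hr', hpunct⟩ := hpunct
  simp only [dist_zero_right] at hpunct
  set ε := min (min ε₁ ε₂) (min (r / 2) (min r' 1)) with hεdef
  have hε : 0 < ε := by positivity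
  have l1 : ε ≤ ε₁ := (min_le_left _ _).trans (min_le_left _ _)
  have l2 : ε ≤ ε₂ := (min_le_left _ _).trans (min_le_right _ _)
  have l3 : ε ≤ r / 2 := (min_le_right _ _).trans (min_le_left _ _)
  have l4 : ε ≤ r' := (min_le_right _ _).trans ((min_le_right _ _).trans (min_le_left _ _))
  have l5 : ε ≤ 1 := (min_le_right _ _).trans ((min_le_right _ _).trans (min_le_right _ _))
  let G : Set ℂ := {z | z ≠ 0 ∧ ‖z‖ < ε ∧ |Complex.arg (z / c)| ≤ θ}
  have hGk : ∀ z ∈ G, k * |Complex.arg (z / c)| ≤ 1 := fun z hz =>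
    (mul_le_mul_of_nonneg_left hz.2.2 hk0.le).trans hkθ
  have hGcon : ∀ z ∈ G, f z ≠ 0 ∧ ‖f z‖ ≤ ‖z‖ * Real.exp (-(‖z‖ / ‖c‖) ^ k / 4) ∧
      ∀ y, ‖y - z‖ ≤ ε₂ * ‖z‖ →
        ‖y - z‖ ^ 2 * ‖f z‖ ^ (2 * k + 3) ≤ ‖f y - f z‖ ^ 2 * ‖z‖ ^ (2 * k + 3) :=
    fun z hz => hcon z hz.1 (hz.2.1.trans_le l2) (hGk z hz)
  have hGthick : ∀ z ∈ G, ∀ y, ‖y - z‖ ≤ ε * ‖z‖ → W (f y) = W y ∧ W (g y) = W y ∧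
      W (h y) = W y ∧ ∀ᶠ y' in 𝓝[≠] y, W y' ≠ W y := fun z hz y hy =>
    hthick z hz.1 (hz.2.1.trans_le l1) (hz.2.2.trans (min_le_left _ _)) y
      (hy.trans (mul_le_mul_of_nonneg_right l1 (norm_nonneg z)))
  have hGself : ∀ z ∈ G, W (f z) = W z ∧ W (g z) = W z ∧
      W (h z) = W z ∧ ∀ᶠ y' in 𝓝[≠] z, W y' ≠ W z := fun z hz =>
    hGthick z hz z (by rw [sub_self, norm_zero]; positivity)
  have hle : ∀ z ∈ G, ‖f z‖ ≤ ‖z‖ := fun z hz => (hGcon z hz).2.1.trans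
    (mul_le_of_le_one_right (norm_nonneg z) (Real.exp_le_one_iff.2 (by
      have : 0 ≤ (‖z‖ / ‖c‖) ^ k := by positivity
      linarith)))
  have hGf : ∀ z ∈ G, f z ∈ G := fun z hz =>
    ⟨(hGcon z hz).1, (hle z hz).trans_lt hz.2.1,
      (hpunct (hz.2.1.trans_le l4) hz.1).1 hz.2.2⟩
  -- As `‖f z‖ ≤ 1`, the bound `q₀ * ‖f z‖ ^ (2 * k + 3)` puts `y'` within `ε / (K + 1) * ‖f z‖` of
  -- `f z`. The inverse `g`, being `K`-Lipschitz, then keeps `g y'` where the contraction estimate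
  -- applies.
  set q₀ : ℝ := (ε / (K + 1)) ^ 2 with hq₀
  have hq₀pos : 0 < q₀ := by positivity
  -- one step backwards
  have step : ∀ q, 0 ≤ q → q ≤ q₀ → ∀ z ∈ G, ∀ y',
      ‖y' - f z‖ ^ 2 ≤ q * ‖f z‖ ^ (2 * k + 3) → y' ≠ f z → W y' = W (f z) →
      ∃ y, ‖y - z‖ ^ 2 ≤ q * ‖z‖ ^ (2 * k + 3) ∧ y ≠ z ∧ W y = W z := by
    intro q hq hqq z hz y' hy' hyne hyW
    have hfzG := hGf z hz
    have hfz0 : 0 < ‖f z‖ := norm_pos_iff.2 hfzG.1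
    have hfz1 : ‖f z‖ ≤ 1 := hfzG.2.1.le.trans l5
    have hd : ‖y' - f z‖ ≤ ε / (K + 1) * ‖f z‖ := by
      refine (pow_le_pow_iff_left₀ (norm_nonneg _) (by positivity) two_ne_zero).1 ?_
      rw [mul_pow, ← hq₀]
      refine hy'.trans (mul_le_mul hqq ?_ (by positivity) hq₀pos.le)
      exact pow_le_pow_of_le_one hfz0.le hfz1 (by omega)
    have hK : ε / (K + 1) ≤ ε := div_le_self hε.le (by simp)
    have hd' : ‖y' - f z‖ ≤ ε * ‖f z‖ :=
      hd.trans (mul_le_mul_of_nonneg_right hK hfz0.le)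
    have hy'r : ‖y'‖ < r := by
      have h1 := norm_le_norm_sub_add y' (f z)
      have h2 := hfzG.2.1
      nlinarith
    have hfzr : ‖f z‖ < r := by linarith [hfzG.2.1]
    obtain ⟨hy's, -, hfgy, -⟩ := hloc hy'r
    obtain ⟨hfzs, -, -, -⟩ := hloc hfzr
    have hgfz : g (f z) = z := (hloc (show ‖z‖ < r by linarith [hz.2.1])).2.1
    have hyz : ‖g y' - z‖ ≤ ε₂ * ‖z‖ := by
      have h1 := hLip.norm_sub_le hy's hfzs
      rw [hgfz] at h1
      calc ‖g y' - z‖ ≤ K * ‖y' - f z‖ := h1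
        _ ≤ K * (ε / (K + 1) * ‖f z‖) := by gcongr
        _ = K / (K + 1) * (ε * ‖f z‖) := by ring
        _ ≤ 1 * (ε * ‖f z‖) := by
          gcongr
          exact (div_le_one (by positivity)).2 (by simp)
        _ ≤ ε₂ * ‖z‖ := by
          rw [one_mul]
          exact mul_le_mul l2 (hle z hz) hfz0.le hε₂.le
    have h3 := (hGcon z hz).2.2 (g y') hyz
    rw [hfgy] at h3
    refine ⟨g y', ?_, ?_, ?_⟩
    · have h4 : ‖g y' - z‖ ^ 2 * ‖f z‖ ^ (2 * k + 3) ≤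
          q * ‖z‖ ^ (2 * k + 3) * ‖f z‖ ^ (2 * k + 3) := by
        refine h3.trans ?_
        calc _ ≤ q * ‖f z‖ ^ (2 * k + 3) * ‖z‖ ^ (2 * k + 3) := by gcongr
          _ = _ := by ring
      exact le_of_mul_le_mul_right h4 (by positivity)
    · intro h5
      rw [h5] at hfgy
      exact hyne hfgy.symm
    · rw [(hGthick _ hfzG y' hd').2.1, hyW, (hGself z hz).1]
  have back : ∀ q, 0 ≤ q → q ≤ q₀ → ∀ n : ℕ, ∀ z ∈ G, ∀ y',
      ‖y' - f^[n] z‖ ^ 2 ≤ q * ‖f^[n] z‖ ^ (2 * k + 3) → y' ≠ f^[n] z → W y' = W (f^[n] z) →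
      ∃ y, ‖y - z‖ ^ 2 ≤ q * ‖z‖ ^ (2 * k + 3) ∧ y ≠ z ∧ W y = W z := by
    intro q hq hqq n
    induction n with
    | zero => exact fun z _ y' h1 h2 h3 => ⟨y', h1, h2, h3⟩
    | succ n ih =>
      intro z hz y' h1 h2 h3
      rw [Function.iterate_succ_apply] at h1 h2 h3
      obtain ⟨y, h4, h5, h6⟩ := ih (f z) (hGf z hz) y' h1 h2 h3
      exact step q hq hqq z hz y h4 h5 h6
  -- the orbit
  obtain ⟨z₀, hz₀⟩ : G.Nonempty := by
    have := rayFilter_neBot hc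
    obtain ⟨z, hz⟩ := this.nonempty_of_mem (raySector_mem (c := c) (lt_min hε hθ))
    exact ⟨z, norm_pos_iff.1 hz.1.1, hz.1.2.trans_le (min_le_left _ _),
      hz.2.le.trans (min_le_right _ _)⟩
  have horb : ∀ n, f^[n] z₀ ∈ G := by
    intro n
    induction n with
    | zero => exact hz₀
    | succ n ih =>
      rw [Function.iterate_succ_apply']
      exact hGf _ ih
  have hlim : Tendsto (fun n => ‖f^[n] z₀‖) atTop (𝓝 0) := by
    refine IsAttractingDirection.tendsto_zero_of_le (k := k) (norm_pos_iff.2 hc)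
      (fun n => norm_pos_iff.2 (horb n).1) fun n => ?_
    rw [Function.iterate_succ_apply']
    exact (hGcon _ (horb n)).2.1
  have hq : Tendsto (fun n => C ^ 2 * ‖f^[n] z₀‖) atTop (𝓝 0) := by
    simpa using hlim.const_mul (C ^ 2)
  -- The pair `(z_n, h z_n)` has squared distance at most `C ^ 2 * ‖z_n‖ ^ (2 * k + 4)`. Its ratio
  -- to `‖z_n‖ ^ (2 * k + 3)` is thus at most `C ^ 2 * ‖z_n‖`, a bound that survives the pull-back
  -- to `z₀` and tends to `0`.
  have hex : ∀ᶠ n in atTop, ∃ y, ‖y - z₀‖ ^ 2 ≤ C ^ 2 * ‖f^[n] z₀‖ * ‖z₀‖ ^ (2 * k + 3) ∧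
      y ≠ z₀ ∧ W y = W z₀ := by
    filter_upwards [hq.eventually (gt_mem_nhds hq₀pos)] with n hn
    have hnG := horb n
    refine back _ (by positivity) hn.le n z₀ hz₀ (h (f^[n] z₀)) ?_
      (hpunct (hnG.2.1.trans_le l4) hnG.1).2 (hGself _ hnG).2.2.1
    have h1 := (hloc (show ‖f^[n] z₀‖ < r by linarith [hnG.2.1])).2.2.2
    refine (pow_le_pow_left₀ (norm_nonneg _) h1 2).trans (le_of_eq ?_)
    ring
  have hloc0 := (hGself z₀ hz₀).2.2.2
  rw [eventually_nhdsWithin_iff, Metric.eventually_nhds_iff] at hloc0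
  obtain ⟨ρ, hρ, hinj⟩ := hloc0
  have hq' : Tendsto (fun n => C ^ 2 * ‖f^[n] z₀‖ * ‖z₀‖ ^ (2 * k + 3)) atTop (𝓝 0) := by
    simpa using hq.mul_const (‖z₀‖ ^ (2 * k + 3))
  obtain ⟨n, ⟨y, hy1, hy2, hy3⟩, hn⟩ :=
    (hex.and (hq'.eventually (gt_mem_nhds (show 0 < ρ ^ 2 by positivity)))).exists
  refine hinj ?_ hy2 hy3
  rw [dist_eq_norm]
  exact lt_of_pow_lt_pow_left₀ 2 hρ.le (hy1.trans_lt hn)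

/-! ### Solvability of groups of germs preserving an affine connection -/

/-- Inside `G`, the derived series of `H` shifted by one lies below that of `K`, so `K` need not be
contained in `H`. -/
theorem Subgroup.isSolvable_of_commutator_le {G : Type*} [Group G] {H K : Subgroup G}
    (h : ⁅H, H⁆ ≤ K) (hK : Group.IsSolvable K) : Group.IsSolvable H := by
  obtain ⟨n, hn⟩ := hK.solvable
  have key : ∀ n, (derivedSeries H (n + 1)).map H.subtype ≤ (derivedSeries K n).map K.subtype := by
    intro n
    induction n with
    | zero =>
      rw [derivedSeries_succ, derivedSeries_zero, derivedSeries_zero, Subgroup.map_commutator,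
        ← MonoidHom.range_eq_map, ← MonoidHom.range_eq_map, Subgroup.range_subtype,
        Subgroup.range_subtype]
      exact h
    | succ n ih =>
      rw [derivedSeries_succ, derivedSeries_succ K, Subgroup.map_commutator,
        Subgroup.map_commutator]
      exact Subgroup.commutator_mono ih ih
  refine ⟨⟨n + 1, ?_⟩⟩
  have h1 := key n
  rw [hn, Subgroup.map_bot, le_bot_iff,
    Subgroup.map_eq_bot_iff_of_injective _ H.subtype_injective] at h1
  exact h1

/-! ### Representatives, multiplier and order of tangency of germs. -/

namespace DiffGerm

/-- A representative of a germ. -/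
noncomputable def rep (φ : DiffGerm) : HolMap :=
  (sameGermAtZero.mk'_surjective (φ : sameGermAtZero.Quotient)).choose

theorem isRep_rep (φ : DiffGerm) : φ.IsRep φ.rep :=
  (sameGermAtZero.mk'_surjective (φ : sameGermAtZero.Quotient)).choose_spec

/-- The function underlying a representative of a germ. -/
noncomputable def fn (φ : DiffGerm) : ℂ → ℂ := φ.rep.fn

theorem IsRep.fn_eq {φ : DiffGerm} {f : HolMap} (h : φ.IsRep f) : φ.fn =ᶠ[𝓝 0] f.fn :=
  sameGermAtZero.eq.1 (φ.isRep_rep.trans h.symm)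

theorem analyticAt (φ : DiffGerm) : AnalyticAt ℂ φ.fn 0 := φ.rep.analyticAt

theorem fn_zero (φ : DiffGerm) : φ.fn 0 = 0 := φ.rep.fn_zero

theorem tendsto (φ : DiffGerm) : Tendsto φ.fn (𝓝 0) (𝓝 0) := φ.rep.tendsto

theorem fn_mul (φ ψ : DiffGerm) : (φ * ψ).fn =ᶠ[𝓝 0] φ.fn ∘ ψ.fn :=
  IsRep.fn_eq (f := φ.rep * ψ.rep) (congrArg₂ (· * ·) φ.isRep_rep ψ.isRep_rep)

theorem fn_one : (1 : DiffGerm).fn =ᶠ[𝓝 0] id := IsRep.fn_eq (f := 1) rfl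

theorem fn_mul_inv (φ : DiffGerm) : ∀ᶠ z in 𝓝 0, φ.fn (φ⁻¹.fn z) = z := by
  have h := φ.fn_mul φ⁻¹
  rw [mul_inv_cancel] at h
  exact h.symm.trans fn_one

theorem eq_of_fn_eq {φ ψ : DiffGerm} (h : φ.fn =ᶠ[𝓝 0] ψ.fn) : φ = ψ :=
  Units.ext (φ.isRep_rep.symm.trans ((sameGermAtZero.eq.2 h).trans ψ.isRep_rep))

/-- The derivative at the fixed point. -/
noncomputable def multiplier : DiffGerm →* ℂ where
  toFun φ := deriv φ.fn 0
  map_one' := by rw [fn_one.deriv_eq, deriv_id]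
  map_mul' φ ψ := by
    rw [(fn_mul φ ψ).deriv_eq, deriv_comp (0 : ℂ) (by rw [fn_zero]; exact
      φ.analyticAt.differentiableAt) ψ.analyticAt.differentiableAt, fn_zero]

theorem deriv_ne_zero (φ : DiffGerm) : deriv φ.fn 0 ≠ 0 := by
  have h : multiplier φ * multiplier φ⁻¹ = 1 := by rw [← map_mul, mul_inv_cancel, map_one]
  exact left_ne_zero_of_mul_eq_one h

theorem tendsto_div {φ : DiffGerm} (h : φ ∈ multiplier.ker) :
    Tendsto (fun z => φ.fn z / z) (𝓝[≠] 0) (𝓝 1) :=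
  tendsto_div_self φ.analyticAt φ.fn_zero h

theorem tendsto_ray {φ : DiffGerm} (h : φ ∈ multiplier.ker) {c : ℂ} (hc : c ≠ 0) :
    Tendsto φ.fn (rayFilter c) (rayFilter c) :=
  tendsto_rayFilter hc (tendsto_div h)

/-- The order of tangency to the identity. -/
theorem exists_order {φ : DiffGerm} (h : φ ∈ multiplier.ker) (h1 : φ ≠ 1) :
    ∃ k : ℕ, 1 ≤ k ∧ ∃ u : ℂ → ℂ, AnalyticAt ℂ u 0 ∧ u 0 ≠ 0 ∧
      ∀ᶠ z in 𝓝 0, φ.fn z = z + z ^ (k + 1) * u z := by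
  have han : AnalyticAt ℂ (fun z => φ.fn z - z) 0 := φ.analyticAt.sub analyticAt_id
  have htop : analyticOrderAt (fun z => φ.fn z - z) 0 ≠ ⊤ := by
    rw [Ne, analyticOrderAt_eq_top]
    intro h2
    refine h1 (eq_of_fn_eq (EventuallyEq.trans ?_ fn_one.symm))
    filter_upwards [h2] with z hz using sub_eq_zero.1 hz
  obtain ⟨n, hn⟩ := ENat.ne_top_iff_exists.1 htop
  obtain ⟨u, hu, hu0, hfu⟩ := han.analyticOrderAt_eq_natCast.1 hn.symm
  simp only [sub_zero, smul_eq_mul] at hfu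
  -- Tangency to the identity gives `z ^ n * u z / z → 0`. For `n ≤ 1`, multiplying by `z ^ (1 - n)`
  -- leaves `u z`, so `u 0` would vanish.
  have hn2 : 2 ≤ n := by
    by_contra hn2
    have hlim : Tendsto (fun z => z ^ n * u z / z) (𝓝[≠] 0) (𝓝 0) := by
      have h3 := (tendsto_div h).sub_const 1
      rw [sub_self] at h3
      refine h3.congr' ?_
      filter_upwards [nhdsWithin_le_nhds hfu, self_mem_nhdsWithin] with z hz (hz0 : z ≠ 0)
      rw [← hz]
      field_simp
    have hu' : Tendsto u (𝓝[≠] 0) (𝓝 (u 0)) :=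
      hu.continuousAt.tendsto.mono_left nhdsWithin_le_nhds
    have hid : Tendsto (fun z : ℂ => z ^ (1 - n)) (𝓝[≠] 0) (𝓝 (0 ^ (1 - n))) :=
      ((continuous_pow (1 - n)).tendsto 0).mono_left nhdsWithin_le_nhds
    have h4 := hid.mul hlim
    rw [mul_zero] at h4
    refine hu0 (tendsto_nhds_unique hu' (h4.congr' ?_))
    filter_upwards [self_mem_nhdsWithin] with z (hz0 : z ≠ 0)
    rw [← mul_div_assoc, ← mul_assoc, ← pow_add, show 1 - n + n = 1 by omega, pow_one,
      mul_div_cancel_left₀ _ hz0]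
  refine ⟨n - 1, by omega, u, hu, hu0, ?_⟩
  filter_upwards [hfu] with z hz
  rw [show n - 1 + 1 = n by omega, ← hz]
  ring

/-- The commutator of two germs tangent to the identity to order `k` is tangent to the identity to
a higher order. -/
theorem lt_order_commutator {φ ψ κ : DiffGerm} (hφ : φ ∈ multiplier.ker) (hψ : ψ ∈ multiplier.ker)
    (hκ : φ * ψ = κ * (ψ * φ)) {k m : ℕ} {u v s : ℂ → ℂ}
    (hu : AnalyticAt ℂ u 0) (hv : AnalyticAt ℂ v 0) (hs : AnalyticAt ℂ s 0) (hs0 : s 0 ≠ 0)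
    (hφu : ∀ᶠ z in 𝓝 0, φ.fn z = z + z ^ (k + 1) * u z)
    (hψv : ∀ᶠ z in 𝓝 0, ψ.fn z = z + z ^ (k + 1) * v z)
    (hκs : ∀ᶠ z in 𝓝 0, κ.fn z = z + z ^ (m + 1) * s z) : k < m := by
  by_contra hmk
  have hlim : ∀ {w : ℂ → ℂ}, AnalyticAt ℂ w 0 → ∀ χ : DiffGerm,
      Tendsto (fun z => w (χ.fn z)) (𝓝[≠] 0) (𝓝 (w 0)) := fun hw χ =>
    hw.continuousAt.tendsto.comp (χ.tendsto.mono_left nhdsWithin_le_nhds)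
  have hlim' : ∀ {w : ℂ → ℂ}, AnalyticAt ℂ w 0 → Tendsto w (𝓝[≠] 0) (𝓝 (w 0)) := fun hw =>
    hw.continuousAt.tendsto.mono_left nhdsWithin_le_nhds
  -- Divide `φψ - ψφ = (κ - id) ∘ (ψφ)` by `z ^ (m + 1)`. The right side tends to `s 0`. The terms
  -- of order `k + 1` on the left cancel, so for `m ≤ k` the left side tends to `0`.
  have hL := ((tendsto_div (mul_mem hψ hφ)).pow (m + 1)).mul (hlim hs (ψ * φ))
  have hB := ((hlim' hv).add (((tendsto_div hψ).pow (k + 1)).mul (hlim hu ψ))).sub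
    ((hlim' hu).add (((tendsto_div hφ).pow (k + 1)).mul (hlim hv φ)))
  have hid : Tendsto (fun z : ℂ => z ^ (k - m)) (𝓝[≠] 0) (𝓝 (0 ^ (k - m))) :=
    ((continuous_pow (k - m)).tendsto 0).mono_left nhdsWithin_le_nhds
  have hR := hid.mul hB
  rw [one_pow, one_mul] at hL
  rw [one_pow, one_mul, one_mul, add_comm (v 0), sub_self, mul_zero] at hR
  refine hs0 (tendsto_nhds_unique (hL.congr' ?_) hR)
  have e1 := hκ ▸ fn_mul κ (ψ * φ)
  have hev : ∀ᶠ z in 𝓝 (0 : ℂ), φ.fn (ψ.fn z) - ψ.fn (φ.fn z) =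
      (ψ * φ).fn z ^ (m + 1) * s ((ψ * φ).fn z) := by
    filter_upwards [fn_mul φ ψ, fn_mul ψ φ, e1, (ψ * φ).tendsto.eventually hκs] with z h1 h2 h3 h4
    simp only [Function.comp_apply] at h1 h2 h3
    rw [← h1, ← h2, h3, h4]
    ring
  filter_upwards [nhdsWithin_le_nhds hev, nhdsWithin_le_nhds hφu, nhdsWithin_le_nhds hψv,
    nhdsWithin_le_nhds (ψ.tendsto.eventually hφu), nhdsWithin_le_nhds (φ.tendsto.eventually hψv),
    self_mem_nhdsWithin] with z h1 h2 h3 h4 h5 (hz : z ≠ 0)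
  have hpow : z ^ (k + 1) = z ^ (k - m) * z ^ (m + 1) := by
    rw [← pow_add]
    congr 1
    omega
  have h6 : φ.fn (ψ.fn z) - ψ.fn (φ.fn z) = z ^ (k + 1) *
      (v z + (ψ.fn z / z) ^ (k + 1) * u (ψ.fn z) -
        (u z + (φ.fn z / z) ^ (k + 1) * v (φ.fn z))) := by
    rw [h4, h5, div_pow, div_pow]
    have h2' : φ.fn z - z - z ^ (k + 1) * u z = 0 := by rw [h2]; ring
    have h3' : ψ.fn z - z - z ^ (k + 1) * v z = 0 := by rw [h3]; ring
    field_simp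
    linear_combination h3' - h2'
  rw [div_pow, div_mul_eq_mul_div, ← h1, h6, hpow]
  field_simp

end DiffGerm

open DiffGerm
open scoped commutatorElement

/-- A flat coordinate is not constant. -/
theorem IsFlatCoordinate.not_eventually_eq {η W : ℂ → ℂ} {c : ℂ} (hc : c ≠ 0)
    (hW : IsFlatCoordinate η c W) (d : ℂ) : ¬ ∀ᶠ z in rayFilter c, W z = d := by
  intro h
  obtain ⟨ε, hε, hS⟩ := (rayFilter_hasBasis c).eventually_iff.1 (h.and hW)
  have hδ : 0 < min 1 ε := by positivity
  have := rayFilter_neBot hc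
  obtain ⟨z, hz⟩ := this.nonempty_of_mem (raySector_mem (c := c) hδ)
  have hsub : raySector c (min 1 ε) ⊆ raySector c ε := fun z hz =>
    ⟨⟨hz.1.1, hz.1.2.trans_le (min_le_right _ _)⟩, hz.2.trans_le (min_le_right _ _)⟩
  have hWd : W =ᶠ[𝓝 z] fun _ => d := by
    filter_upwards [(raySector_isOpen hc (min_le_left _ _)).mem_nhds hz] with y hy
    exact (hS (hsub hy)).1
  refine (hS (hsub hz)).2.2.1 ?_
  rw [hWd.deriv_eq, deriv_const]

/-- The germs of `K` which act on the coordinates `W c` by translations with translation lengths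
in `B`. -/
def translationSubgroup (K : Subgroup DiffGerm) (hK : K ≤ multiplier.ker) (W : ℂ → ℂ → ℂ)
    (B : AddSubgroup ℂ) : Subgroup DiffGerm where
  carrier := {φ | φ ∈ K ∧ ∀ c ≠ 0, ∃ b ∈ B, ∀ᶠ z in rayFilter c, W c (φ.fn z) = W c z + b}
  one_mem' := by
    refine ⟨one_mem K, fun c _ => ⟨0, zero_mem B, ?_⟩⟩
    filter_upwards [(rayFilter_le c).trans nhdsWithin_le_nhds fn_one] with z hz
    rw [hz, id, add_zero]
  mul_mem' := by
    rintro φ ψ ⟨hφ, hφ'⟩ ⟨hψ, hψ'⟩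
    refine ⟨mul_mem hφ hψ, fun c hc => ?_⟩
    obtain ⟨b, hb, hb'⟩ := hφ' c hc
    obtain ⟨d, hd, hd'⟩ := hψ' c hc
    refine ⟨d + b, add_mem hd hb, ?_⟩
    filter_upwards [(rayFilter_le c).trans nhdsWithin_le_nhds (fn_mul φ ψ),
      (tendsto_ray (hK hψ) hc).eventually hb', hd'] with z h1 h2 h3
    rw [h1, Function.comp_apply, h2, h3, add_assoc]
  inv_mem' := by
    rintro φ ⟨hφ, hφ'⟩
    refine ⟨inv_mem hφ, fun c hc => ?_⟩
    obtain ⟨b, hb, hb'⟩ := hφ' c hc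
    refine ⟨-b, neg_mem hb, ?_⟩
    filter_upwards [(rayFilter_le c).trans nhdsWithin_le_nhds φ.fn_mul_inv,
      (tendsto_ray (hK (inv_mem hφ)) hc).eventually hb'] with z h1 h2
    rw [h1] at h2
    linear_combination -h2

/-! ### The chain of commutator subgroups. -/

section Solvable

variable {H : Subgroup DiffGerm} {η : ℂ → ℂ} {W : ℂ → ℂ → ℂ}

theorem commutator_le_multiplier_ker (H : Subgroup DiffGerm) : ⁅H, H⁆ ≤ H ⊓ multiplier.ker := by
  refine le_inf H.commutator_le_self (Subgroup.commutator_le.2 fun φ _ ψ _ => ?_)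
  have h1 : multiplier φ * multiplier φ⁻¹ = 1 := by rw [← map_mul, mul_inv_cancel, map_one]
  have h2 : multiplier ψ * multiplier ψ⁻¹ = 1 := by rw [← map_mul, mul_inv_cancel, map_one]
  rw [MonoidHom.mem_ker, commutatorElement_def, map_mul, map_mul, map_mul]
  linear_combination (multiplier ψ * multiplier ψ⁻¹) * h1 + h2

/-- Written as `φψ = κψφ`, the commutator relation can be read in flat coordinates without inverses.
-/
theorem eventually_commutator (φ ψ : DiffGerm) (c : ℂ) : ∀ᶠ z in rayFilter c,
    φ.fn (ψ.fn z) = ⁅φ, ψ⁆.fn (ψ.fn (φ.fn z)) := by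
  have h : φ * ψ = ⁅φ, ψ⁆ * (ψ * φ) := by
    rw [commutatorElement_def]
    group
  have h1 := h ▸ fn_mul ⁅φ, ψ⁆ (ψ * φ)
  filter_upwards [(rayFilter_le c).trans nhdsWithin_le_nhds h1,
    (rayFilter_le c).trans nhdsWithin_le_nhds (fn_mul φ ψ),
    (rayFilter_le c).trans nhdsWithin_le_nhds (fn_mul ψ φ)] with z h1 h2 h3
  rw [Function.comp_apply] at h1 h2 h3
  rw [← h2, h1, h3]

/-- In `W c` both sides of `φψ = κψφ` are affine. If `κ` had linear part `a ≠ 1`, comparing them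
would make `W c` constant. -/
theorem commutator_le_translationSubgroup (hH : H ≤ multiplier.ker)
    (hη : ∀ φ ∈ H, PreservesConnection η φ.fn) (hW : ∀ c ≠ 0, IsFlatCoordinate η c (W c)) :
    ⁅H, H⁆ ≤ translationSubgroup H hH W ⊤ := by
  refine Subgroup.commutator_le.2 fun φ hφ ψ hψ => ?_
  have hκ : ⁅φ, ψ⁆ ∈ H := H.commutator_le_self (Subgroup.commutator_mem_commutator hφ hψ)
  refine ⟨hκ, fun c hc => ?_⟩
  have aff : ∀ χ ∈ H, ∃ a b : ℂ, a ≠ 0 ∧ ∀ᶠ z in rayFilter c, W c (χ.fn z) = a * W c z + b :=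
    fun χ hχ => (hW c hc).exists_affine hc χ.analyticAt χ.fn_zero (hH hχ) (hη χ hχ)
  obtain ⟨a₁, b₁, ha₁, h₁⟩ := aff φ hφ
  obtain ⟨a₂, b₂, ha₂, h₂⟩ := aff ψ hψ
  obtain ⟨a, b, ha, h⟩ := aff _ hκ
  have t₁ := tendsto_ray (hH hφ) hc
  have t₂ := tendsto_ray (hH hψ) hc
  have heq : ∀ᶠ z in rayFilter c, a₁ * a₂ * (1 - a) * W c z =
      a * (a₂ * b₁ + b₂) + b - (a₁ * b₂ + b₁) := by
    filter_upwards [eventually_commutator φ ψ c, h₁, h₂, t₂.eventually h₁, t₁.eventually h₂,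
      (t₂.comp t₁).eventually h] with z e0 e1 e2 e3 e4 e5
    rw [Function.comp_apply] at e5
    rw [← e0, e3, e4, e1, e2] at e5
    linear_combination e5
  have ha1 : a = 1 := by
    by_contra hne
    have hne' : a₁ * a₂ * (1 - a) ≠ 0 :=
      mul_ne_zero (mul_ne_zero ha₁ ha₂) (sub_ne_zero.2 (Ne.symm hne))
    refine (hW c hc).not_eventually_eq hc
      ((a * (a₂ * b₁ + b₂) + b - (a₁ * b₂ + b₁)) / (a₁ * a₂ * (1 - a))) ?_
    filter_upwards [heq] with z hz
    rw [eq_div_iff hne', mul_comm, hz]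
  refine ⟨b, AddSubgroup.mem_top b, ?_⟩
  filter_upwards [h] with z hz
  rw [hz, ha1, one_mul]

theorem commutator_translationSubgroup_le (hH : H ≤ multiplier.ker) (W : ℂ → ℂ → ℂ) :
    ⁅translationSubgroup H hH W ⊤, translationSubgroup H hH W ⊤⁆ ≤
      translationSubgroup H hH W ⊥ := by
  refine Subgroup.commutator_le.2 fun φ hφ ψ hψ => ?_
  have hκ := (translationSubgroup H hH W ⊤).commutator_le_self
    (Subgroup.commutator_mem_commutator hφ hψ)
  refine ⟨hκ.1, fun c hc => ⟨0, zero_mem _, ?_⟩⟩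
  obtain ⟨b₁, -, h₁⟩ := hφ.2 c hc
  obtain ⟨b₂, -, h₂⟩ := hψ.2 c hc
  obtain ⟨b, -, h⟩ := hκ.2 c hc
  have t₁ := tendsto_ray (hH hφ.1) hc
  have t₂ := tendsto_ray (hH hψ.1) hc
  have heq : ∀ᶠ z in rayFilter c, b = 0 := by
    filter_upwards [eventually_commutator φ ψ c, h₁, h₂, t₂.eventually h₁, t₁.eventually h₂,
      (t₂.comp t₁).eventually h] with z e0 e1 e2 e3 e4 e5
    rw [Function.comp_apply] at e5
    rw [← e0, e3, e4, e1, e2] at e5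
    linear_combination -e5
  have := rayFilter_neBot hc
  obtain ⟨z, hz⟩ := heq.exists
  filter_upwards [h] with z' hz'
  rw [hz', hz]

/-- Nontrivial germs tangent to the identity which leave the flat coordinates invariant have the
same order of tangency. -/
theorem not_order_lt (hH : H ≤ multiplier.ker) (hW : ∀ c ≠ 0, IsFlatCoordinate η c (W c))
    {φ ψ : DiffGerm} (hφ : φ ∈ translationSubgroup H hH W ⊥)
    (hψ : ψ ∈ translationSubgroup H hH W ⊥) {k l : ℕ} (hk : 1 ≤ k) {u v : ℂ → ℂ}
    (hu : AnalyticAt ℂ u 0) (hu0 : u 0 ≠ 0) (hv : AnalyticAt ℂ v 0) (hv0 : v 0 ≠ 0)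
    (hφu : ∀ᶠ z in 𝓝 0, φ.fn z = z + z ^ (k + 1) * u z)
    (hψv : ∀ᶠ z in 𝓝 0, ψ.fn z = z + z ^ (l + 1) * v z) : ¬ k < l := by
  intro hkl
  -- Any `k`-th root of `-1 / u 0` is an attracting direction of `φ`. It depends on `φ`, which is
  -- why invariance is required along all rays.
  obtain ⟨c, hck⟩ := IsAlgClosed.exists_pow_nat_eq (-1 / u 0) (show 0 < k by omega)
  have hc : c ≠ 0 := by
    rintro rfl
    rw [zero_pow (by omega)] at hck
    exact div_ne_zero (neg_ne_zero.2 one_ne_zero) hu0 hck.symm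
  have hinv : ∀ χ ∈ translationSubgroup H hH W ⊥, ∀ᶠ z in rayFilter c, W c (χ.fn z) = W c z := by
    intro χ hχ
    obtain ⟨b, hb, h⟩ := hχ.2 c hc
    rw [AddSubgroup.mem_bot.1 hb] at h
    simpa using h
  have hf : IsAttractingDirection k c φ.fn := by
    refine ⟨u, hu, ?_, hφu⟩
    rw [hck]
    field_simp
  have hinvφ := φ⁻¹.fn_mul_inv
  rw [inv_inv] at hinvφ
  refine hf.false_of_invariant (g := φ⁻¹.fn) (h := ψ.fn) (C := ‖v 0‖ + 1) hk hc φ⁻¹.analyticAt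
    hinvφ φ.fn_mul_inv ?_ ?_ (hinv φ hφ) (hinv _ (inv_mem hφ)) (hinv ψ hψ) (hW c hc).eventually_ne
  · filter_upwards [hψv, hv.continuousAt.norm.eventually (gt_mem_nhds (lt_add_one ‖v 0‖)),
      Metric.ball_mem_nhds (0 : ℂ) one_pos] with z h1 h2 h3
    rw [mem_ball_zero_iff] at h3
    rw [h1, add_sub_cancel_left, norm_mul, norm_pow, mul_comm]
    exact mul_le_mul h2.le (pow_le_pow_of_le_one (norm_nonneg z) h3.le (by omega))
      (by positivity) (by positivity)
  · filter_upwards [nhdsWithin_le_nhds hψv,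
      nhdsWithin_le_nhds (hv.continuousAt.eventually_ne hv0), self_mem_nhdsWithin]
      with z h1 h2 (h3 : z ≠ 0) h4
    rw [h1, add_eq_left] at h4
    exact mul_ne_zero (pow_ne_zero _ h3) h2 h4

/-- A nontrivial commutator would again leave the flat coordinates invariant, yet have a higher
order than the common order of `φ` and `ψ`. -/
theorem commute_of_mem_translationSubgroup_bot (hH : H ≤ multiplier.ker)
    (hW : ∀ c ≠ 0, IsFlatCoordinate η c (W c)) {φ ψ : DiffGerm}
    (hφ : φ ∈ translationSubgroup H hH W ⊥) (hψ : ψ ∈ translationSubgroup H hH W ⊥) :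
    φ * ψ = ψ * φ := by
  by_cases hφ1 : φ = 1
  · rw [hφ1, one_mul, mul_one]
  by_cases hψ1 : ψ = 1
  · rw [hψ1, one_mul, mul_one]
  rw [← commutatorElement_eq_one_iff_mul_comm]
  by_contra hκ1
  have hκ := (translationSubgroup H hH W ⊥).commutator_le_self
    (Subgroup.commutator_mem_commutator hφ hψ)
  obtain ⟨k, hk, u, hu, hu0, hφu⟩ := exists_order (hH hφ.1) hφ1
  obtain ⟨l, hl, v, hv, hv0, hψv⟩ := exists_order (hH hψ.1) hψ1
  obtain ⟨m, hm, s, hs, hs0, hκs⟩ := exists_order (hH hκ.1) hκ1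
  obtain rfl : k = l := le_antisymm
    (not_lt.1 (not_order_lt hH hW hψ hφ hl hv hv0 hu hu0 hψv hφu))
    (not_lt.1 (not_order_lt hH hW hφ hψ hk hu hu0 hv hv0 hφu hψv))
  refine not_order_lt hH hW hφ hκ hk hu hu0 hs hs0 hφu hκs
    (lt_order_commutator (hH hφ.1) (hH hψ.1) ?_ hu hv hs hs0 hφu hψv hκs)
  rw [commutatorElement_def]
  group

/-- A group of germs preserving a holomorphic affine connection on a punctured neighbourhood of the
fixed point is solvable. -/
theorem isSolvable_of_preservesConnection (hη : ∀ᶠ z in 𝓝[≠] (0 : ℂ), AnalyticAt ℂ η z)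
    (hH : ∀ φ ∈ H, PreservesConnection η φ.fn) : Group.IsSolvable H := by
  have hWex : ∀ c : ℂ, ∃ W, c ≠ 0 → IsFlatCoordinate η c W := by
    intro c
    by_cases hc : c = 0
    · exact ⟨0, fun h => absurd hc h⟩
    · obtain ⟨W, hW⟩ := exists_isFlatCoordinate hη hc
      exact ⟨W, fun _ => hW⟩
  choose W hW using hWex
  have hker : H ⊓ multiplier.ker ≤ multiplier.ker := inf_le_right
  refine Subgroup.isSolvable_of_commutator_le (commutator_le_multiplier_ker H) ?_
  refine Subgroup.isSolvable_of_commutator_le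
    (commutator_le_translationSubgroup hker (fun φ hφ => hH φ hφ.1) hW) ?_
  refine Subgroup.isSolvable_of_commutator_le (commutator_translationSubgroup_le hker W) ?_
  exact Group.isSolvable_of_comm fun φ ψ =>
    Subtype.ext (commute_of_mem_translationSubgroup_bot hker hW φ.2 ψ.2)

end Solvable

theorem PreservesConnection.congr {η f g : ℂ → ℂ} (hf : PreservesConnection η f)
    (h : g =ᶠ[𝓝 0] f) : PreservesConnection η g := by
  have h' : ∀ᶠ z in 𝓝 (0 : ℂ), g =ᶠ[𝓝 z] f := h.eventuallyEq_nhds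
  filter_upwards [hf, nhdsWithin_le_nhds h'] with z hz hz'
  rw [hz'.self_of_nhds, hz'.deriv_eq, hz'.deriv.deriv_eq, hz]

theorem mainTheorem4 {ℓ : ℕ} {M : Type*} [TopologicalSpace M] [T2Space M]
    [ChartedSpace (EuclideanSpace ℝ (Fin (ℓ + 2))) M] [IsManifold (𝓡 (ℓ + 2)) ∞ M]
    (F : TransverselyHolomorphicFoliation ℓ M) (Λ : Set M) (hΛ : F.IsCompactCurve Λ)
    (haff : F.IsTransverselyAffineOn Λᶜ)
    (L : Set M) (hL : F.IsLeaf L) (hLΛ : L ⊆ Λ)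
    (p : M) (hp : p ∈ L) (D : F.TransverseDisc p) :
    Group.IsSolvable (F.holonomyGroup D) := by
  obtain ⟨η, hη, hpres⟩ :=
    TransverselyHolomorphicFoliation.exists_connection hΛ haff (hLΛ hp) D
  refine isSolvable_of_preservesConnection hη ?_
  rintro φ ⟨f, hf, hf'⟩
  refine (hpres f ?_ hf').congr hf.fn_eq
  rw [← hf.fn_eq.deriv_eq]
  exact φ.deriv_ne_zero
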